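/- **Weak solenoids and germinal holonomy.** A presentation is a sequence of finite coverings $p_{\ell+1}\colon M_{\ell+1}\to M_\ell$ ($\ell\ge 0$) of constant degree $>1$ between compact connected manifolds without boundary of a fixed dimension $n\ge 1$; its inverse limit $\varprojlim M_\ell$ is a weak solenoid, whose leaves are its path components. Let $S$ be a space. A transverse section $V_0$ of $S$ is given by a homeomorphism $S\cong\varprojlim M_\ell$ for some presentation and a point $x_0\in M_0$: it is the fibre over $x_0$ of the resulting projection $S\to M_0$. The group $G_0=\pi_1(M_0,x_0)$ acts on $V_0$ by the global holonomy $\Phi_0$: $\Phi_0(g)(y)$ is the end point of the lift to $S$, starting at $y$, of a loop representing $g$. For $x\in V_0$ let $K_x=\{g\in G_0:\Phi_0(g)(x)=x\}$, and let $\mathrm{Germ}(\Phi_0,x)$ be the quotient of $K_x$ that identifies $g_1,g_2$ whenever $\Phi_0(g_1)$ and $\Phi_0(g_2)$ agree on some open neighbourhood of $x$ in $V_0$. The germinal holonomy at $x$ is trivial if $\mathrm{Germ}(\Phi_0,x)$ is trivial; it is locally trivial if there is a single open neighbourhood $U\subset V_0$ of $x$ on which every $\Phi_0(g)$, $g\in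 K_x$, is the identity. **The Schori solenoid.** Let $X_0$ be the closed orientable surface of genus $2$ obtained from a sphere with four holes by gluing the boundary circles in two pairs; the two pairs become the curves $C_0$ and $D_0$. Explicitly, the compact planar domain $1\le|z|\le 20$, $|z-6|\ge 1$, $|z+6|\ge 1$ is glued by $z\sim 20z$ for $|z|=1$ and by $z\sim w$ for $|z-6|=1$, $(z-6)(w+6)=1$. Fix a base point $x_0$ off these curves, a longitude $\alpha$ through $x_0$ crossing $C_0$ once and not meeting $D_0$, and a longitude $\beta$ through $x_0$ crossing $D_0$ once and not meeting $C_0$. Inductively, given the covering $X_\ell\to X_0$ and the base point $x_\ell$, let $C_\ell$ be a component of the preimage of $C_0$ that is crossed by the closed loop through $x_\ell$ covering $\alpha$ (the loop around the handle $H_\ell$), and $D_\ell$ a component of the preimage of $D_0$ that is crossed by the closed loop through $x_\ell$ covering $\beta$ (the loop around the handle $F_\ell$). Cut $X_\ell$ along $C_\ell$ and $D_\ell$, take three copies of the cut surface, numbered $0,1,2$, and reglue: crossing $C_\ell$ in the positive direction exchanges the copies $0$ and $1$ and preserves the copy $2$; crossing $D_\ell$ in the positive direction exchanges the copies $1$ and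 $2$ and preserves the copy $0$. The result is $X_{\ell+1}$, with its obvious map $f_\ell^{\ell+1}\colon X_{\ell+1}\to X_\ell$; let $x_{\ell+1}$ be the point over $x_\ell$ in the copy number $1$. The Schori solenoid is $\mathcal S=\varprojlim X_\ell$. **Theorem.** For every choice of the curves $C_\ell$, $D_\ell$ as above, the following hold. 1. The maps $f_\ell^{\ell+1}\colon X_{\ell+1}\to X_\ell$ form a presentation of a $2$-dimensional weak solenoid; each of them is a $3$-fold covering, and it is not regular: for every $x\in X_{\ell+1}$ the image of $\pi_1(X_{\ell+1},x)$ in $\pi_1(X_\ell,f_\ell^{\ell+1}(x))$ is not a normal subgroup. 2. There is a leaf $L$ of $\mathcal S$ with trivial germinal holonomy: for every transverse section $V_0$ of $\mathcal S$ and every $y\in V_0\cap L$, $\mathrm{Germ}(\Phi_0,y)$ is trivial. 3. For every transverse section $V_0$ of $\mathcal S$ and every point $x\in V_0$, the germinal holonomy $\mathrm{Germ}(\Phi_0,x)$ is not locally trivial. -/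

import Mathlib

universe u v

/-! ### Weak solenoids, transverse sections and germinal holonomy -/

/-- The inverse limit of a sequence of maps `p ℓ : M (ℓ + 1) → M ℓ`, as a subspace of the
product. -/
def InverseLimit (M : ℕ → Type u) (p : ∀ ℓ, M (ℓ + 1) → M ℓ) : Type u :=
  {x : ∀ ℓ, M ℓ // ∀ ℓ, p ℓ (x (ℓ + 1)) = x ℓ}

instance (M : ℕ → Type u) [∀ ℓ, TopologicalSpace (M ℓ)] (p : ∀ ℓ, M (ℓ + 1) → M ℓ) :
    TopologicalSpace (InverseLimit M p) :=
  inferInstanceAs (TopologicalSpace {x : ∀ ℓ, M ℓ // ∀ ℓ, p ℓ (x (ℓ + 1)) = x ℓ})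

/-- A presentation of an `n`-dimensional weak solenoid: every `M ℓ` is a compact connected
`n`-manifold without boundary, and every `p ℓ` is a finite covering of constant degree `> 1`. -/
structure IsPresentation (n : ℕ) (M : ℕ → Type u) [∀ ℓ, TopologicalSpace (M ℓ)]
    (p : ∀ ℓ, M (ℓ + 1) → M ℓ) : Prop where
  dim_pos : 1 ≤ n
  compact : ∀ ℓ, CompactSpace (M ℓ)
  connected : ∀ ℓ, ConnectedSpace (M ℓ)
  hausdorff : ∀ ℓ, T2Space (M ℓ)
  manifold : ∀ ℓ, Nonempty (ChartedSpace (EuclideanSpace ℝ (Fin n)) (M ℓ))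
  covering : ∀ ℓ, IsCoveringMap (p ℓ)
  degree : ∀ ℓ, ∃ m : ℕ, 1 < m ∧ ∀ y, Nat.card (p ℓ ⁻¹' {y}) = m

/-- A transverse section of a space `S` homeomorphic to a weak solenoid: it is given by a
presentation of `S`, that is, an identification of `S` with a weak solenoid `lim M ℓ`, and a point
`base` of `M 0`. The section itself is the fibre (`carrier`) of the bundle projection `S → M 0` over
`base`. The presentation is arbitrary, it need not be one by which `S` was constructed; for instance
the presentations obtained from a given one by forgetting the first `n` terms yield as sections
the cylinder sets of its fibres. -/
structure TransverseSection (S : Type v) [TopologicalSpace S] where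
  dim : ℕ
  M : ℕ → Type u
  [top : ∀ ℓ, TopologicalSpace (M ℓ)]
  bond : ∀ ℓ, M (ℓ + 1) → M ℓ
  isPresentation : IsPresentation dim M bond
  homeo : S ≃ₜ InverseLimit M bond
  base : M 0

attribute [instance] TransverseSection.top

namespace TransverseSection

variable {S : Type v} [TopologicalSpace S] (V : TransverseSection.{u} S)

/-- The bundle projection `S → M 0`. -/
def proj (s : S) : V.M 0 := (V.homeo s).1 0

/-- The points of the section. -/
def carrier : Set S := {s | V.proj s = V.base}

/-- The group acting on the section, `π₁(M 0, base)`. -/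
abbrev Grp : Type u := FundamentalGroup (V.M 0) V.base

/-- The graph of the global holonomy map of `g`: `V.Holonomy g y z` says that `h_g(y) = z`, i.e.
that the lift to `S`, starting at `y`, of a loop representing `g` ends at `z`. -/
def Holonomy (g : V.Grp) (y z : V.carrier) : Prop :=
  ∃ γ : Path V.base V.base, FundamentalGroup.fromPath (Path.Homotopic.Quotient.mk γ) = g ∧
    ∃ Γ : C(unitInterval, S), (∀ t, V.proj (Γ t) = γ t) ∧ Γ 0 = y ∧ Γ 1 = z

/-- The isotropy group at `x` of the global holonomy action (as a set). -/
def isotropy (x : V.carrier) : Set V.Grp := {g | V.Holonomy g x x}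

/-- `g₁` and `g₂` have the same germinal holonomy at `x`: the restrictions of `h_{g₁}` and
`h_{g₂}` to some open neighbourhood of `x` in the section agree. -/
def germSetoid (x : V.carrier) : Setoid (V.isotropy x) where
  r g₁ g₂ := ∃ U : Set V.carrier, IsOpen U ∧ x ∈ U ∧
    ∀ y ∈ U, ∀ z, V.Holonomy g₁ y z ↔ V.Holonomy g₂ y z
  iseqv :=
    { refl := fun _ => ⟨Set.univ, isOpen_univ, trivial, fun _ _ _ => Iff.rfl⟩
      symm := fun ⟨U, hU, hx, h⟩ => ⟨U, hU, hx, fun y hy z => (h y hy z).symm⟩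
      trans := fun ⟨U, hU, hx, h⟩ ⟨W, hW, hx', h'⟩ => ⟨U ∩ W, hU.inter hW, ⟨hx, hx'⟩,
        fun y hy z => (h y hy.1 z).trans (h' y hy.2 z)⟩ }

/-- The set underlying the germinal holonomy group at `x`. -/
def Germ (x : V.carrier) : Type u := Quotient (V.germSetoid x)

/-- The germinal holonomy at `x` is trivial. -/
def GermTrivial (x : V.carrier) : Prop := Subsingleton (V.Germ x)

/-- The germinal holonomy at `x` is locally trivial: one open neighbourhood of `x` in the section is
fixed pointwise by all elements of the isotropy group of `x`. -/
def GermLocallyTrivial (x : V.carrier) : Prop :=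
  ∃ U : Set V.carrier, IsOpen U ∧ x ∈ U ∧ ∀ g ∈ V.isotropy x, ∀ y ∈ U, V.Holonomy g y y

end TransverseSection

/-! ### The Schori solenoid -/

namespace Schori

/-- An open sphere with four holes: the plane annulus `1/2 < |z| < 40` without the two closed
discs of radius `1/2` around `6` and `-6`. It is the genus two surface cut open along the two curves
`C₀` and `D₀`, thickened by collars: cutting along the core curves of the collars would
give the compact domain `1 ≤ |z| ≤ 20`, `1 ≤ |z - 6|`, `1 ≤ |z + 6|`. -/
def Piece : Type :=
  {z : ℂ // 1 / 2 < ‖z‖ ∧ ‖z‖ < 40 ∧ 1 / 2 < ‖z - 6‖ ∧ 1 / 2 < ‖z + 6‖}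

instance : TopologicalSpace Piece := inferInstanceAs (TopologicalSpace (Subtype _))

/-- The pieces of which the surface `X_ℓ` consists are indexed by words of length `ℓ` in three
letters: `X_{ℓ+1}` is made of three copies of (the cut surface) `X_ℓ`, numbered `0, 1, 2`, and the
piece `(v, i)` of `X_{ℓ+1}` is the copy of the piece `v` of `X_ℓ` in the copy number `i`. -/
def Sheet : ℕ → Type
  | 0 => Unit
  | ℓ + 1 => Sheet ℓ × Fin 3

instance (ℓ : ℕ) : TopologicalSpace (Sheet ℓ) := ⊥

instance (ℓ : ℕ) : DiscreteTopology (Sheet ℓ) := ⟨rfl⟩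

/-- The piece containing the base point `x_ℓ`: `x_{ℓ+1}` lies in the second copy over `x_ℓ`. -/
def baseSheet : ∀ ℓ, Sheet ℓ
  | 0 => ()
  | ℓ + 1 => (baseSheet ℓ, 1)

open Classical in
/-- Cutting along a curve and regluing. Let `c ℓ` be the piece from which the curve along which
`X_ℓ` is cut is crossed. When crossing a curve from the piece `(v, i)` of `X_{ℓ+1}`, one
arrives in the piece lying over the one reached from `v` in `X_ℓ`; one stays in the copy
number `i` unless the curve crossed is the cut one (`v = c ℓ`), where one passes to the
copy number `τ i`. -/
noncomputable def regluing (τ : Equiv.Perm (Fin 3)) (c : ∀ ℓ, Sheet ℓ) :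
    ∀ ℓ, Equiv.Perm (Sheet ℓ)
  | 0 => 1
  | ℓ + 1 => Equiv.prodShear (regluing τ c ℓ) (fun v => if v = c ℓ then τ else 1)

/-- A choice of the curves along which the surfaces are cut. The curve `C_ℓ` is
one of the curves in `X_ℓ` that lie over `C₀` and that are crossed by the long loop around the
handle `H_ℓ`, which is the lift through `x_ℓ` of (a power of) the longitude crossing `C₀`.
Likewise for `D_ℓ` and the handle `F_ℓ`. The curves are recorded by the pieces from which they are
crossed. At the copies `0, 1, 2`, the two sides of the cut `C_ℓ` are reglued by exchanging
`0` and `1`, those of `D_ℓ` by exchanging `1` and `2`. -/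
structure Cuts where
  C : ∀ ℓ, Sheet ℓ
  D : ∀ ℓ, Sheet ℓ
  C_mem : ∀ ℓ, (regluing (Equiv.swap 0 1) C ℓ).SameCycle (baseSheet ℓ) (C ℓ)
  D_mem : ∀ ℓ, (regluing (Equiv.swap 1 2) D ℓ).SameCycle (baseSheet ℓ) (D ℓ)

/-- Gluing of the pieces indexed by `I`: the collar `1/2 < |z| < 2` of the piece `v` is glued to the
collar `10 < |w| < 40` of the piece `a v` by `w = 20 z`, and the collar `1/2 < |z - 6| < 2` of
the piece `v` to the collar `1/2 < |w + 6| < 2` of the piece `b v` by `(z - 6) (w + 6) = 1`.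
(The bounds hold automatically for points of the pieces.) -/
inductive Glue {I : Type} (a b : Equiv.Perm I) : I × Piece → I × Piece → Prop
  | crossC (v : I) (z w : Piece) (h : w.1 = 20 * z.1) : Glue a b (v, z) (a v, w)
  | crossD (v : I) (z w : Piece) (h : (z.1 - 6) * (w.1 + 6) = 1) : Glue a b (v, z) (b v, w)

/-- The closed surface `X_ℓ`. -/
def Surface (κ : Cuts) (ℓ : ℕ) : Type :=
  Quot (Glue (regluing (Equiv.swap 0 1) κ.C ℓ) (regluing (Equiv.swap 1 2) κ.D ℓ))

instance (κ : Cuts) (ℓ : ℕ) : TopologicalSpace (Surface κ ℓ) :=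
  inferInstanceAs (TopologicalSpace (Quot _))

/-- The covering `X_{ℓ+1} → X_ℓ`, which forgets the number of the copy. -/
def bond (κ : Cuts) (ℓ : ℕ) : Surface κ (ℓ + 1) → Surface κ ℓ :=
  Quot.map (fun q : Sheet (ℓ + 1) × Piece => ((q.1.1, q.2) : Sheet ℓ × Piece)) (by
    rintro _ _ (⟨v, z, w, h⟩ | ⟨v, z, w, h⟩)
    · exact Glue.crossC v.1 z w h
    · exact Glue.crossD v.1 z w h)

theorem continuous_bond (κ : Cuts) (ℓ : ℕ) : Continuous (bond κ ℓ) := by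
  refine continuous_quot_lift _ (continuous_quot_mk.comp ?_)
  exact ((continuous_of_discreteTopology (f := fun v : Sheet (ℓ + 1) => v.1)).comp
    continuous_fst).prodMk continuous_snd

/-- The Schori solenoid. -/
abbrev Solenoid (κ : Cuts) : Type := InverseLimit (Surface κ) (bond κ)

end Schori

/-!
Each `X_ℓ` is glued from copies of one planar piece, the sphere with four holes, and the gluing is
recorded by two permutations of the copies, one for each of the curves `C` and `D`. The free group
on these two letters therefore acts on the copies at every level, and on their inverse limit, the
compact space of ends. Every leaf of the solenoid is the image of the surface glued from the Cayley
graph of the free group, so a loop in a leaf is a word fixing an end, and its holonomy is the action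
of that word on the ends.

A countable group acting on a Baire space has a point without holonomy, because the frontiers of its
closed fixed point sets are nowhere dense; the leaf of such an end has trivial germinal holonomy. On
the other hand every end has isotropy that moves arbitrarily close ends: translate the end into copy
`2` over the base piece of `X_ℓ` and run around the handle that `C_ℓ` cuts. This word exchanges the
copies `0` and `1`. It fixes the end, because all later lifts of `C` that are cut lie on the cycle
of the base piece, which is in copy `1`, while crossing `C` preserves the copy `2`. The two handles
also provide the non-regularity of the bonding maps.

The holonomy of two sections with unrelated presentations is compared through loops in leaves:
whether the projection of a loop lifts to a loop at a nearby point is preserved by transport along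
leaves, and a lift that agrees with the loop up to a sufficiently deep level of one presentation
stays close to it in the base of the other.
-/

open Topology

/-! ### Group actions and iteration -/

section Actions

variable (G : Type*) {X : Type*} [Group G] [MulAction G X] [TopologicalSpace X]

/-- A point without holonomy: every group element fixing it is the identity near it. This is the
triviality of the group of germs at `x` of the elements of the isotropy group. -/
def IsHolonomyFree (x : X) : Prop :=
  ∀ g : G, g • x = x → ∀ᶠ y in 𝓝 x, g • y = y

variable {G} [ContinuousConstSMul G X]

theorem IsHolonomyFree.smul {x : X} (hx : IsHolonomyFree G x) (a : G) :
    IsHolonomyFree G (a • x) := by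
  intro g hg
  have hfix : (a⁻¹ * g * a) • x = x := by rw [mul_smul, mul_smul, hg, inv_smul_smul]
  have hlim : Filter.Tendsto (a⁻¹ • ·) (𝓝 (a • x)) (𝓝 x) := by
    simpa using (continuous_const_smul a⁻¹).tendsto (a • x)
  filter_upwards [hlim.eventually (hx _ hfix)] with y hy
  simpa [mul_smul] using hy

theorem dense_setOf_isHolonomyFree [Countable G] [BaireSpace X] [T2Space X] :
    Dense {x : X | IsHolonomyFree G x} := by
  -- Off the frontiers of the closed sets of fixed points there is no holonomy.
  let F : G → Set X := fun g => {x | g • x = x}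
  have hF : ∀ g, IsClosed (F g) := fun g => isClosed_eq (continuous_const_smul g) continuous_id
  have hdense : Dense (⋂ g, (frontier (F g))ᶜ) :=
    dense_iInter_of_isOpen (fun g => isClosed_frontier.isOpen_compl) fun g =>
      interior_eq_empty_iff_dense_compl.1 (interior_frontier (hF g))
  refine hdense.mono fun x hx g hg => ?_
  by_contra hev
  exact Set.mem_iInter.1 hx g ⟨subset_closure hg, fun h => hev (mem_interior_iff_mem_nhds.1 h)⟩

end Actions

theorem count_iterate_eq_minimalPeriod {X : Type*} [DecidableEq X] {f : X → X} {x : X}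
    (hx : x ∈ f.periodicPts) (m : ℕ) :
    Nat.count (fun j => f^[j] x = f^[m] x) (f.minimalPeriod x) = 1 := by
  have hpos := Function.minimalPeriod_pos_of_mem_periodicPts hx
  rw [Nat.count_eq_card_filter_range, Finset.card_eq_one]
  refine ⟨m % f.minimalPeriod x, Finset.ext fun j => ?_⟩
  rw [Finset.mem_filter, Finset.mem_range, Finset.mem_singleton]
  constructor
  · rintro ⟨hj, h⟩
    exact Function.iterate_injOn_Iio_minimalPeriod hj (Nat.mod_lt m hpos)
      (h.trans Function.iterate_mod_minimalPeriod_eq.symm)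
  · rintro rfl
    exact ⟨Nat.mod_lt m hpos, Function.iterate_mod_minimalPeriod_eq⟩

/-! ### Topological preliminaries -/

theorem isPreconnected_setOf_norm_mem {E : Type*} [NormedAddCommGroup E] [NormedSpace ℝ E]
    (hE : 1 < Module.rank ℝ E) {s : Set ℝ} (hs : IsPreconnected s) (hpos : ∀ r ∈ s, 0 < r) :
    IsPreconnected {x : E | ‖x‖ ∈ s} := by
  have himage : (fun y : ℝ × E => y.1 • y.2) '' (s ×ˢ Metric.sphere 0 1) = {x : E | ‖x‖ ∈ s} := by
    ext x
    constructor
    · rintro ⟨⟨r, y⟩, ⟨hr, hy⟩, rfl⟩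
      have hy : ‖y‖ = 1 := mem_sphere_zero_iff_norm.1 hy
      change ‖r • y‖ ∈ s
      rwa [norm_smul, hy, mul_one, Real.norm_of_nonneg (hpos r hr).le]
    · intro hx
      have hx0 : ‖x‖ ≠ 0 := (hpos _ hx).ne'
      refine ⟨(‖x‖, ‖x‖⁻¹ • x), ⟨hx, ?_⟩, smul_inv_smul₀ hx0 x⟩
      rw [mem_sphere_zero_iff_norm, norm_smul, norm_inv, norm_norm, inv_mul_cancel₀ hx0]
  rw [← himage]
  exact (hs.prod (isPreconnected_sphere hE 0 1)).image _ continuous_smul.continuousOn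

/-- Charts straighten a neighbourhood of a point to a ball, where `H` is given by segments. -/
theorem exists_local_equiconnection (E : Type*) [NormedAddCommGroup E] [NormedSpace ℝ E]
    {B : Type*} [TopologicalSpace B] [ChartedSpace E B] (b : B) :
    ∃ U : Set B, IsOpen U ∧ b ∈ U ∧ ∃ H : C(unitInterval × U × U, B),
      (∀ x y, H (0, x, y) = x) ∧ (∀ x y, H (1, x, y) = y) ∧ ∀ t x, H (t, x, x) = x := by
  let e := chartAt E b
  have hb : b ∈ e.source := mem_chart_source E b
  obtain ⟨r, hr, hball⟩ := Metric.isOpen_iff.1 e.open_target (e b) (e.map_source hb)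
  let U := e.source ∩ e ⁻¹' Metric.ball (e b) r
  have heU : Continuous fun x : U => e x :=
    e.continuousOn.comp_continuous continuous_subtype_val fun x => x.2.1
  let h : unitInterval × U × U → E := fun y => AffineMap.lineMap (e y.2.1) (e y.2.2) (y.1 : ℝ)
  have hh : Continuous h := by
    simp only [h, AffineMap.lineMap_apply_module]
    exact ((by fun_prop : Continuous fun y : unitInterval × U × U => 1 - (y.1 : ℝ)).smul
      (heU.comp (by fun_prop))).add ((by fun_prop : Continuous fun y : unitInterval × U × U =>
        (y.1 : ℝ)).smul (heU.comp (by fun_prop)))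
  have hmem : ∀ y, h y ∈ e.target := fun y =>
    hball ((convex_ball (e b) r).lineMap_mem y.2.1.2.2 y.2.2.2.2 y.1.2)
  refine ⟨U, e.isOpen_inter_preimage Metric.isOpen_ball, ⟨hb, Metric.mem_ball_self hr⟩,
    ⟨fun y => e.symm (h y), e.continuousOn_symm.comp_continuous hh hmem⟩, ?_, ?_, ?_⟩
  · intro x y
    simpa [h] using e.left_inv x.2.1
  · intro x y
    simpa [h] using e.left_inv y.2.1
  · intro t x
    simpa [h] using e.left_inv x.2.1

theorem exists_isPreconnected_star_refinement {B ι : Type*} [TopologicalSpace B] [CompactSpace B]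
    [R1Space B] [LocallyConnectedSpace B] {U : ι → Set B} (hUo : ∀ i, IsOpen (U i))
    (hU : ⋃ i, U i = Set.univ) :
    ∃ (C : B → Set B) (k : B → ι), (∀ x, IsOpen (C x) ∧ x ∈ C x ∧ IsPreconnected (C x)) ∧
      ∀ x y, (C x ∩ C y).Nonempty → C y ⊆ U (k x) := by
  let _ : UniformSpace B := uniformSpaceOfCompactR1
  obtain ⟨E, hE, hEU⟩ := lebesgue_number_lemma isCompact_univ hUo hU.ge
  choose k hk using fun x => hEU x (Set.mem_univ x)
  obtain ⟨D, hD, hDs, hDE⟩ := comp_comp_symm_mem_uniformity_sets hE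
  choose C hCD hCo hxC hC using fun x => locallyConnectedSpace_iff_subsets_isOpen_isConnected.1
    ‹LocallyConnectedSpace B› x _ (UniformSpace.ball_mem_nhds x hD)
  refine ⟨C, k, fun x => ⟨hCo x, hxC x, (hC x).isPreconnected⟩, ?_⟩
  rintro x y ⟨u, hux, huy⟩ w hw
  exact hk x (hDE ⟨y, ⟨u, hCD x hux, hDs.symm _ _ (hCD y huy)⟩, hCD y hw⟩)

section Coverings

variable {E X : Type*} [TopologicalSpace E] [TopologicalSpace X] {p : E → X}

theorem monodromy_mk_eq (cov : IsCoveringMap p) {b c : X} {γ : Path b c} {Γ : C(unitInterval, E)}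
    (hΓ : ∀ t, p (Γ t) = γ t) (e : p ⁻¹' {b}) (h0 : Γ 0 = e) :
    (cov.monodromy (Path.Homotopic.Quotient.mk γ) e : E) = Γ 1 := by
  have h : Γ = cov.liftPath γ e (γ.source.trans e.2.symm) :=
    (cov.eq_liftPath_iff' _).2 ⟨funext hΓ, h0⟩
  exact congrArg (fun Δ : C(unitInterval, E) => Δ 1) h.symm

theorem mem_range_map_iff_monodromyPerm_eq (cov : IsCoveringMap p) {x : E}
    {g : FundamentalGroup X (p x)} :
    g ∈ (FundamentalGroup.map (⟨p, cov.continuous⟩ : C(E, X)) x).range ↔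
      cov.monodromyPerm (p x) g ⟨x, rfl⟩ = ⟨x, rfl⟩ := by
  constructor
  · rintro ⟨θ, rfl⟩
    exact cov.monodromy_map θ
  · intro hg
    obtain ⟨γ, rfl⟩ := Path.Homotopic.Quotient.mk_surjective g
    have hend : cov.liftPath γ x γ.source 1 = x := congrArg Subtype.val hg
    refine ⟨FundamentalGroup.fromPath (.mk ⟨cov.liftPath γ x γ.source,
      cov.liftPath_zero .., hend⟩), congrArg Path.Homotopic.Quotient.mk ?_⟩
    ext t
    exact congrFun (cov.liftPath_lifts γ.toContinuousMap x γ.source) t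

theorem not_normal_range_map_of_monodromyPerm (cov : IsCoveringMap p) {x : E}
    {g h : FundamentalGroup X (p x)} (hg : cov.monodromyPerm (p x) g ⟨x, rfl⟩ = ⟨x, rfl⟩)
    (hgh : cov.monodromyPerm (p x) g (cov.monodromyPerm (p x) h ⟨x, rfl⟩) ≠
      cov.monodromyPerm (p x) h ⟨x, rfl⟩) :
    ¬ (FundamentalGroup.map (⟨p, cov.continuous⟩ : C(E, X)) x).range.Normal := by
  intro hN
  have hconj := (mem_range_map_iff_monodromyPerm_eq cov).1
    (hN.conj_mem g ((mem_range_map_iff_monodromyPerm_eq cov).2 hg) h⁻¹)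
  rw [inv_inv, map_mul, map_mul, map_inv, Equiv.Perm.mul_apply, Equiv.Perm.mul_apply,
    Equiv.Perm.inv_eq_iff_eq] at hconj
  exact hgh hconj

end Coverings

/-! ### Inverse limits of coverings -/

namespace InverseLimit

section Levels

variable {M : ℕ → Type u} {p : ∀ ℓ, M (ℓ + 1) → M ℓ}

theorem level_eq_of_le {x y : InverseLimit M p} {m n : ℕ} (hmn : m ≤ n) (h : x.1 n = y.1 n) :
    x.1 m = y.1 m := by
  induction n, hmn using Nat.le_induction with
  | base => exact h
  | succ k _ ih => exact ih (by rw [← x.2 k, ← y.2 k, h])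

end Levels

variable {M : ℕ → Type u} [∀ ℓ, TopologicalSpace (M ℓ)] {p : ∀ ℓ, M (ℓ + 1) → M ℓ}
  {A : Type*} [TopologicalSpace A]

theorem continuous_level (n : ℕ) : Continuous fun x : InverseLimit M p => x.1 n :=
  (continuous_apply n).comp continuous_subtype_val

theorem continuous_iff_level {f : A → InverseLimit M p} :
    Continuous f ↔ ∀ n, Continuous fun a => (f a).1 n :=
  ⟨fun h n => (continuous_level n).comp h,
    fun h => Continuous.subtype_mk (continuous_pi h) fun a => (f a).2⟩

theorem t2Space [∀ ℓ, T2Space (M ℓ)] : T2Space (InverseLimit M p) :=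
  inferInstanceAs (T2Space {x : ∀ ℓ, M ℓ // ∀ ℓ, p ℓ (x (ℓ + 1)) = x ℓ})

theorem compactSpace (hM : ∀ ℓ, CompactSpace (M ℓ)) (hM' : ∀ ℓ, T2Space (M ℓ))
    (hp : ∀ ℓ, Continuous (p ℓ)) : CompactSpace (InverseLimit M p) := by
  have hclosed : IsClosed {x : ∀ ℓ, M ℓ | ∀ ℓ, p ℓ (x (ℓ + 1)) = x ℓ} := by
    rw [Set.ofPred_forall]
    exact isClosed_iInter fun ℓ =>
      isClosed_eq ((hp ℓ).comp (continuous_apply _)) (continuous_apply _)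
  exact isCompact_iff_compactSpace.1 hclosed.isCompact

theorem exists_level_eq_imp_mem (hM : ∀ ℓ, CompactSpace (M ℓ)) (hM' : ∀ ℓ, T2Space (M ℓ))
    (hp : ∀ ℓ, Continuous (p ℓ)) {O : Set (InverseLimit M p × InverseLimit M p)} (hO : IsOpen O)
    (hdiag : ∀ a, (a, a) ∈ O) : ∃ n, ∀ a b : InverseLimit M p, a.1 n = b.1 n → (a, b) ∈ O := by
  have := compactSpace hM hM' hp
  by_contra! h
  let K : ℕ → Set (InverseLimit M p × InverseLimit M p) := fun n => {x | x.1.1 n = x.2.1 n} ∩ Oᶜ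
  have hK : ∀ n, IsClosed (K n) := fun n =>
    (isClosed_eq ((continuous_level n).comp continuous_fst)
      ((continuous_level n).comp continuous_snd)).inter hO.isClosed_compl
  obtain ⟨⟨a, b⟩, hab⟩ := IsCompact.nonempty_iInter_of_sequence_nonempty_isCompact_isClosed K
    (fun n x hx => ⟨level_eq_of_le n.le_succ hx.1, hx.2⟩)
    (fun n => let ⟨a, b, h1, h2⟩ := h n; ⟨(a, b), h1, h2⟩) (hK 0).isCompact hK
  rw [Set.mem_iInter] at hab
  obtain rfl : a = b := Subtype.ext (funext fun n => (hab n).1)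
  exact (hab 0).2 (hdiag a)

theorem exists_cylinder_subset (hM : ∀ ℓ, CompactSpace (M ℓ)) (hM' : ∀ ℓ, T2Space (M ℓ))
    (hp : ∀ ℓ, Continuous (p ℓ)) {x : InverseLimit M p} {U : Set (InverseLimit M p)}
    (hU : U ∈ 𝓝 x) : ∃ n, ∀ y : InverseLimit M p, y.1 n = x.1 n → y ∈ U := by
  have := t2Space (p := p)
  have hopen : IsOpen {y : InverseLimit M p × InverseLimit M p | y.1 ≠ x ∨ y.2 ∈ interior U} :=
    (isOpen_ne_fun continuous_fst continuous_const).union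
      (isOpen_interior.preimage continuous_snd)
  obtain ⟨n, hn⟩ := exists_level_eq_imp_mem hM hM' hp hopen fun a =>
    (ne_or_eq a x).imp_right (by rintro rfl; exact mem_interior_iff_mem_nhds.2 hU)
  exact ⟨n, fun y hy => interior_subset ((hn x y hy.symm).resolve_left fun h => h rfl)⟩

theorem eventually_level_eq (hp : ∀ ℓ, IsCoveringMap (p ℓ)) (x : InverseLimit M p) (n : ℕ) :
    ∀ᶠ y in 𝓝 x, y.1 0 = x.1 0 → y.1 n = x.1 n := by
  induction n with
  | zero => exact .of_forall fun _ h => h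
  | succ n ih =>
    obtain ⟨e, he, hpe⟩ := (hp n).isLocalHomeomorph (x.1 (n + 1))
    filter_upwards [ih, (continuous_level (n + 1)).continuousAt.preimage_mem_nhds
      (e.open_source.mem_nhds he)] with y hy hye h0
    exact e.injOn hye he (by rw [← hpe, y.2, x.2, hy h0])

theorem level_eq_of_lift [PreconnectedSpace A] (hp : ∀ ℓ, IsCoveringMap (p ℓ))
    {f g : A → InverseLimit M p} (hf : Continuous f) (hg : Continuous g)
    (h0 : ∀ a, (f a).1 0 = (g a).1 0) {n : ℕ} {a₀ : A} (h : (f a₀).1 n = (g a₀).1 n) (a : A) :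
    (f a).1 n = (g a).1 n := by
  induction n generalizing a with
  | zero => exact h0 a
  | succ n ih =>
    refine congrFun ((hp n).eq_of_comp_eq ((continuous_level (n + 1)).comp hf)
      ((continuous_level (n + 1)).comp hg) (funext fun b => ?_) a₀ h) a
    simpa only [Function.comp_apply, (f b).2 n, (g b).2 n] using ih (level_eq_of_le n.le_succ h) b

theorem eq_of_lift [PreconnectedSpace A] (hp : ∀ ℓ, IsCoveringMap (p ℓ))
    {f g : A → InverseLimit M p} (hf : Continuous f) (hg : Continuous g)
    (h0 : ∀ a, (f a).1 0 = (g a).1 0) {a₀ : A} (h : f a₀ = g a₀) : f = g :=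
  funext fun a => Subtype.ext <| funext fun n => level_eq_of_lift hp hf hg h0 (by rw [h]) a

theorem exists_homotopy_lift (hp : ∀ ℓ, IsCoveringMap (p ℓ)) (H : C(unitInterval × A, M 0))
    (f : C(A, InverseLimit M p)) (H0 : ∀ a, H (0, a) = (f a).1 0) :
    ∃ H' : C(unitInterval × A, InverseLimit M p),
      (∀ x, (H' x).1 0 = H x) ∧ ∀ a, H' (0, a) = f a := by
  let F : ∀ n, C(A, M n) := fun n => ⟨fun a => (f a).1 n, (continuous_level n).comp f.2⟩
  have hF : ∀ n (g : C(unitInterval × A, M n)), (∀ a, g (0, a) = F n a) →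
      ∀ a, g (0, a) = p n (F (n + 1) a) := fun n g hg a => (hg a).trans ((f a).2 n).symm
  let G : ∀ n, {g : C(unitInterval × A, M n) // ∀ a, g (0, a) = F n a} := fun n =>
    Nat.rec ⟨H, H0⟩ (fun n g => ⟨(hp n).liftHomotopy g.1 (F (n + 1)) (hF n g.1 g.2),
      (hp n).liftHomotopy_zero _ _ _⟩) n
  have hG : ∀ x n, p n ((G (n + 1)).1 x) = (G n).1 x := fun x n =>
    congrFun ((hp n).liftHomotopy_lifts (G n).1 (F (n + 1)) (hF n _ (G n).2)) x
  exact ⟨⟨fun x => ⟨fun n => (G n).1 x, hG x⟩, continuous_iff_level.2 fun n => (G n).1.2⟩,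
    fun _ => rfl, fun a => Subtype.ext (funext fun n => (G n).2 a)⟩

end InverseLimit

/-! ### Transverse sections -/

namespace TransverseSection

variable {S : Type v} [TopologicalSpace S] (V : TransverseSection.{u} S)
  {A : Type*} [TopologicalSpace A]

/-- The projection of `S` to the `n`-th space of the presentation. -/
def level (n : ℕ) (s : S) : V.M n := (V.homeo s).1 n

theorem continuous_level (n : ℕ) : Continuous (V.level n) :=
  (InverseLimit.continuous_level n).comp V.homeo.continuous

@[fun_prop]
theorem continuous_proj : Continuous V.proj := V.continuous_level 0

theorem exists_level_eq_imp_mem {O : Set (S × S)} (hO : IsOpen O) (hdiag : ∀ a, (a, a) ∈ O) :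
    ∃ n, ∀ a b, V.level n a = V.level n b → (a, b) ∈ O := by
  have hV := V.isPresentation
  obtain ⟨n, hn⟩ := InverseLimit.exists_level_eq_imp_mem hV.compact hV.hausdorff
    (fun ℓ => (hV.covering ℓ).continuous)
    (hO.preimage (V.homeo.symm.continuous.prodMap V.homeo.symm.continuous)) fun _ => hdiag _
  exact ⟨n, fun a b h => by simpa using hn (V.homeo a) (V.homeo b) h⟩

theorem eventually_level_eq (x : S) (n : ℕ) :
    ∀ᶠ y in 𝓝 x, V.proj y = V.proj x → V.level n y = V.level n x :=
  V.homeo.continuous.continuousAt.eventually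
    (InverseLimit.eventually_level_eq V.isPresentation.covering (V.homeo x) n)

theorem level_eq_of_lift [PreconnectedSpace A] {f g : A → S} (hf : Continuous f)
    (hg : Continuous g) (h0 : ∀ a, V.proj (f a) = V.proj (g a)) {n : ℕ} {a₀ : A}
    (h : V.level n (f a₀) = V.level n (g a₀)) (a : A) : V.level n (f a) = V.level n (g a) :=
  InverseLimit.level_eq_of_lift V.isPresentation.covering (V.homeo.continuous.comp hf)
    (V.homeo.continuous.comp hg) h0 h a

theorem eq_of_lift [PreconnectedSpace A] {f g : A → S} (hf : Continuous f) (hg : Continuous g)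
    (h0 : ∀ a, V.proj (f a) = V.proj (g a)) {a₀ : A} (h : f a₀ = g a₀) (a : A) : f a = g a :=
  V.homeo.injective <| congrFun (InverseLimit.eq_of_lift V.isPresentation.covering
    (V.homeo.continuous.comp hf) (V.homeo.continuous.comp hg) h0 (congrArg V.homeo h)) a

theorem eqOn_of_lift {C : Set A} (hC : IsPreconnected C) {f g : A → S} (hf : ContinuousOn f C)
    (hg : ContinuousOn g C) (h0 : ∀ a ∈ C, V.proj (f a) = V.proj (g a)) {a₀ : A} (ha₀ : a₀ ∈ C)
    (h : f a₀ = g a₀) : Set.EqOn f g C := by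
  have := isPreconnected_iff_preconnectedSpace.1 hC
  exact fun a ha => V.eq_of_lift hf.domRestrict hg.domRestrict (fun a => h0 a a.2)
    (a₀ := ⟨a₀, ha₀⟩) h ⟨a, ha⟩

theorem exists_homotopy_lift (H : C(unitInterval × A, V.M 0)) (f : C(A, S))
    (H0 : ∀ a, H (0, a) = V.proj (f a)) :
    ∃ H' : C(unitInterval × A, S), (∀ x, V.proj (H' x) = H x) ∧ ∀ a, H' (0, a) = f a := by
  obtain ⟨H', hH', hH'0⟩ := InverseLimit.exists_homotopy_lift V.isPresentation.covering H
    ⟨fun a => V.homeo (f a), V.homeo.continuous.comp f.continuous⟩ H0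
  refine ⟨(V.homeo.symm : C(_, S)).comp H', fun x => ?_, fun a => ?_⟩
  · rw [← hH' x]; simp [proj]
  · exact (congrArg V.homeo.symm (hH'0 a)).trans (V.homeo.symm_apply_apply _)

theorem exists_path_lift (γ : C(unitInterval, V.M 0)) {y : S} (h : γ 0 = V.proj y) :
    ∃ Γ : C(unitInterval, S), (∀ t, V.proj (Γ t) = γ t) ∧ Γ 0 = y := by
  obtain ⟨H, hH, hH0⟩ := V.exists_homotopy_lift (A := Unit) (γ.comp ContinuousMap.fst)
    (.const _ y) fun _ => h
  exact ⟨H.comp ((ContinuousMap.id _).prodMk (.const _ ())), fun _ => hH _, hH0 ()⟩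

theorem lift_end_eq_of_homotopic {b c : V.M 0} {γ₁ γ₂ : Path b c} (h : γ₁.Homotopic γ₂)
    {Γ₁ Γ₂ : C(unitInterval, S)} (h₁ : ∀ t, V.proj (Γ₁ t) = γ₁ t)
    (h₂ : ∀ t, V.proj (Γ₂ t) = γ₂ t) (h0 : Γ₁ 0 = Γ₂ 0) : Γ₁ 1 = Γ₂ 1 := by
  obtain ⟨F⟩ := h
  obtain ⟨H, hH, hH0⟩ := V.exists_homotopy_lift (F.toContinuousMap.comp ContinuousMap.prodSwap)
    (.const _ (Γ₁ 0)) fun s => by simp [h₁]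
  have hend : ∀ (s : unitInterval) (Γ : C(unitInterval, S)), (∀ t, V.proj (Γ t) = F (s, t)) →
      Γ 0 = Γ₁ 0 → Γ 1 = H (1, s) := fun s Γ hΓ hΓ0 =>
    V.eq_of_lift Γ.continuous (g := fun t => H (t, s)) (by fun_prop)
      (fun t => by rw [hΓ, hH]; rfl) (a₀ := 0) (by rw [hΓ0, hH0]; rfl) 1
  have hconst : H (1, 0) = H (1, 1) :=
    V.eq_of_lift (f := fun _ : unitInterval => H (1, 0)) (g := fun s => H (1, s)) (by fun_prop)
      (by fun_prop) (fun s => by simp [hH]) (a₀ := 0) rfl 1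
  rw [hend 0 Γ₁ (by simpa using h₁) rfl, hend 1 Γ₂ (by simpa using h₂) h0.symm, hconst]

theorem holonomy_fromPath_mk_iff {γ : Path V.base V.base} {y z : V.carrier} :
    V.Holonomy (FundamentalGroup.fromPath (.mk γ)) y z ↔
      ∃ Γ : C(unitInterval, S), (∀ t, V.proj (Γ t) = γ t) ∧ Γ 0 = y ∧ Γ 1 = z := by
  refine ⟨?_, fun h => ⟨γ, rfl, h⟩⟩
  rintro ⟨δ, hδ, Δ, hΔ, hΔ0, hΔ1⟩
  obtain ⟨Γ, hΓ, hΓ0⟩ := V.exists_path_lift γ.toContinuousMap (γ.source.trans y.2.symm)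
  refine ⟨Γ, hΓ, hΓ0, ?_⟩
  rw [← hΔ1, V.lift_end_eq_of_homotopic (Path.Homotopic.Quotient.exact hδ) hΔ hΓ
    (hΔ0.trans hΓ0.symm)]

/-! ### Transport along leaves -/

/-- `T` transports points `a` of `S` along leaves to points `T (a, v)` over `v`, whenever `W`
relates the projection of `a` to `v`; outside `W` the values of `T` are irrelevant. -/
structure IsTransport (W : Set (V.M 0 × V.M 0)) (T : S × V.M 0 → S) : Prop where
  continuousOn : ContinuousOn T {x | (V.proj x.1, x.2) ∈ W}
  proj_apply : ∀ {a v}, (V.proj a, v) ∈ W → V.proj (T (a, v)) = v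
  apply_proj : ∀ {a}, (V.proj a, V.proj a) ∈ W → T (a, V.proj a) = a

variable {V}

theorem IsTransport.mono {W W' : Set (V.M 0 × V.M 0)} {T : S × V.M 0 → S}
    (hT : V.IsTransport W T) (hW : W' ⊆ W) : V.IsTransport W' T where
  continuousOn := hT.continuousOn.mono fun _ hx => hW hx
  proj_apply h := hT.proj_apply (hW h)
  apply_proj h := hT.apply_proj (hW h)

theorem IsTransport.apply_eq {C : Set (V.M 0)} (hC : IsPreconnected C) {T T' : S × V.M 0 → S}
    (hT : V.IsTransport (C ×ˢ C) T) (hT' : V.IsTransport (C ×ˢ C) T') {a : S} {v : V.M 0}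
    (ha : V.proj a ∈ C) (hv : v ∈ C) : T (a, v) = T' (a, v) :=
  V.eqOn_of_lift hC (hT.continuousOn.comp (by fun_prop) fun _ hw => ⟨ha, hw⟩)
    (hT'.continuousOn.comp (by fun_prop) fun _ hw => ⟨ha, hw⟩)
    (fun w hw => (hT.proj_apply ⟨ha, hw⟩).trans (hT'.proj_apply ⟨ha, hw⟩).symm) ha
    ((hT.apply_proj ⟨ha, ha⟩).trans (hT'.apply_proj ⟨ha, ha⟩).symm) hv

theorem isOpen_transport_domain {W : Set (V.M 0 × V.M 0)} (hW : IsOpen W) :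
    IsOpen {x : S × V.M 0 | (V.proj x.1, x.2) ∈ W} :=
  hW.preimage (by fun_prop)

theorem IsTransport.exists_glue {ι : Type*} {C : ι → Set (V.M 0)} (hC : ∀ i, IsOpen (C i))
    {T : ι → S × V.M 0 → S} (hT : ∀ i, V.IsTransport (C i ×ˢ C i) (T i))
    (hagree : ∀ i j a v, (V.proj a, v) ∈ C i ×ˢ C i → (V.proj a, v) ∈ C j ×ˢ C j →
      T i (a, v) = T j (a, v)) :
    ∃ T', V.IsTransport (⋃ i, C i ×ˢ C i) T' := by
  classical
  let T' : S × V.M 0 → S := fun x =>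
    if h : ∃ i, (V.proj x.1, x.2) ∈ C i ×ˢ C i then T h.choose x else x.1
  have hT' : ∀ {i a v}, (V.proj a, v) ∈ C i ×ˢ C i → T' (a, v) = T i (a, v) := by
    intro i a v hi
    have h : ∃ i, (V.proj a, v) ∈ C i ×ˢ C i := ⟨i, hi⟩
    simp only [T', dif_pos h]
    exact hagree _ _ a v h.choose_spec hi
  refine ⟨T', fun x hx => ?_, fun {a v} h => ?_, fun {a} h => ?_⟩
  · obtain ⟨i, hi⟩ := Set.mem_iUnion.1 hx
    have hn := (isOpen_transport_domain ((hC i).prod (hC i))).mem_nhds hi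
    exact (((hT i).continuousOn.continuousAt hn).congr
      (Filter.mem_of_superset hn fun y hy => (hT' hy).symm)).continuousWithinAt
  · obtain ⟨i, hi⟩ := Set.mem_iUnion.1 h
    rw [hT' hi, (hT i).proj_apply hi]
  · obtain ⟨i, hi⟩ := Set.mem_iUnion.1 h
    rw [hT' hi, (hT i).apply_proj hi]

theorem exists_isTransport_of_equiconnection {U : Set (V.M 0)} (H : C(unitInterval × U × U, V.M 0))
    (H0 : ∀ x y, H (0, x, y) = x) (H1 : ∀ x y, H (1, x, y) = y) (Hd : ∀ t x, H (t, x, x) = x) :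
    ∃ T, V.IsTransport (U ×ˢ U) T := by
  classical
  let W : Set (S × V.M 0) := {x | (V.proj x.1, x.2) ∈ U ×ˢ U}
  let q : C(W, U × U) := ⟨fun x => (⟨V.proj x.1.1, x.2.1⟩, ⟨x.1.2, x.2.2⟩), by fun_prop⟩
  obtain ⟨H', hH', hH'0⟩ := V.exists_homotopy_lift (H.comp ((ContinuousMap.id _).prodMap q))
    ⟨fun x : W => x.1.1, by fun_prop⟩ fun x => H0 _ _
  refine ⟨fun x => if hx : x ∈ W then H' (1, ⟨x, hx⟩) else x.1, ?_, fun {a v} hW => ?_,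
    fun {a} hW => ?_⟩
  · rw [continuousOn_iff_continuous_domRestrict]
    refine (show Continuous fun x : W => H' (1, x) by fun_prop).congr fun x => ?_
    have hx : x.1 ∈ W := x.2
    rw [Set.domRestrict, dif_pos hx]
  · have hW : (a, v) ∈ W := hW
    rw [dif_pos hW, hH']
    exact H1 _ _
  · have hW : (a, V.proj a) ∈ W := hW
    rw [dif_pos hW]
    exact V.eq_of_lift (f := fun t => H' (t, ⟨(a, V.proj a), hW⟩)) (g := fun _ => a)
      (by fun_prop) continuous_const (fun t => (hH' _).trans (Hd t _)) (hH'0 _) 1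

variable (V)

theorem locallyConnectedSpace : LocallyConnectedSpace (V.M 0) := by
  obtain ⟨_⟩ := V.isPresentation.manifold 0
  exact ChartedSpace.locallyConnectedSpace (EuclideanSpace ℝ (Fin V.dim)) _

theorem exists_isTransport :
    ∃ W : Set (V.M 0 × V.M 0), IsOpen W ∧ (∀ b, (b, b) ∈ W) ∧ ∃ T, V.IsTransport W T := by
  obtain ⟨_⟩ := V.isPresentation.manifold 0
  have := V.isPresentation.compact 0
  have := V.isPresentation.hausdorff 0
  have := V.locallyConnectedSpace
  choose U hUo hbU H H0 H1 Hd using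
    exists_local_equiconnection (B := V.M 0) (EuclideanSpace ℝ (Fin V.dim))
  choose T hT using fun b => exists_isTransport_of_equiconnection (H b) (H0 b) (H1 b) (Hd b)
  obtain ⟨C, k, hC, hCU⟩ := exists_isPreconnected_star_refinement hUo
    (Set.eq_univ_of_forall fun b => Set.mem_iUnion.2 ⟨b, hbU b⟩)
  have hTC : ∀ x y, (C x ∩ C y).Nonempty → V.IsTransport (C y ×ˢ C y) (T (k x)) := fun x y hxy =>
    (hT (k x)).mono (Set.prod_mono (hCU x y hxy) (hCU x y hxy))
  have hTself : ∀ x, V.IsTransport (C x ×ˢ C x) (T (k x)) := fun x =>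
    hTC x x ⟨x, (hC x).2.1, (hC x).2.1⟩
  obtain ⟨T', hT'⟩ := IsTransport.exists_glue (fun x => (hC x).1) hTself
    fun x y a v hx hy => (hTC x y ⟨_, hx.1, hy.1⟩).apply_eq (hC y).2.2 (hTself y) hy.1 hy.2
  exact ⟨_, isOpen_iUnion fun x => (hC x).1.prod (hC x).1,
    fun b => Set.mem_iUnion.2 ⟨b, (hC b).2.1, (hC b).2.1⟩, T', hT'⟩

/-! ### Comparison of the holonomy of two sections -/

/-- `V.LoopLifts Γ z`: the projection of the loop `Γ` to the base of the presentation lifts to a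
loop at `z`. This expresses that the holonomy along `Γ` fixes `z` without reference to `V.base`. -/
def LoopLifts (Γ : C(unitInterval, S)) (z : S) : Prop :=
  ∃ Γ' : C(unitInterval, S), (∀ t, V.proj (Γ' t) = V.proj (Γ t)) ∧ Γ' 0 = z ∧ Γ' 1 = z

variable {V}

theorem IsTransport.loopLifts {W : Set (V.M 0 × V.M 0)} {T : S × V.M 0 → S}
    (hT : V.IsTransport W T) {Γ Δ : C(unitInterval, S)} (hΓ : Γ 0 = Γ 1) (hΔ : Δ 0 = Δ 1)
    (hclose : ∀ t, (V.proj (Δ t), V.proj (Γ t)) ∈ W) : V.LoopLifts Γ (T (Δ 0, V.proj (Γ 0))) :=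
  ⟨⟨fun t => T (Δ t, V.proj (Γ t)), hT.continuousOn.comp_continuous (by fun_prop) hclose⟩,
    fun t => hT.proj_apply (hclose t), rfl, by simp only [ContinuousMap.coe_mk, hΓ, hΔ]⟩

universe w

variable (V) (V' : TransverseSection.{w} S)

/-- The point `z` is obtained from `z'` by transport along `V`. -/
theorem IsTransport.eventually_exists_apply_eq {W' : Set (V'.M 0 × V'.M 0)}
    {T' : S × V'.M 0 → S} (hT' : V'.IsTransport W' T') (hWo' : IsOpen W')
    (hWd' : ∀ b, (b, b) ∈ W') (x : S) {U : Set S} (hU : U ∈ 𝓝 x) :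
    ∀ᶠ z' in 𝓝 x, V'.proj z' = V'.proj x →
      ∃ z ∈ U, V.proj z = V.proj x ∧ T' (z, V'.proj x) = z' := by
  obtain ⟨W, hWo, hWd, T, hT⟩ := V.exists_isTransport
  have hTx : T (x, V.proj x) = x := hT.apply_proj (hWd _)
  have hU' : U ∩ {b | (V'.proj b, V'.proj x) ∈ W'} ∈ 𝓝 x :=
    Filter.inter_mem hU ((hWo'.preimage (by fun_prop)).mem_nhds (hWd' _))
  have hdom : {y : S × V.M 0 | (V.proj y.1, y.2) ∈ W} ∈ 𝓝 (x, V.proj x) :=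
    (isOpen_transport_domain hWo).mem_nhds (hWd _)
  obtain ⟨N, hN, C₀, hC₀, hsub⟩ := mem_nhds_prod_iff.1 (Filter.inter_mem hdom
    ((hT.continuousOn.continuousAt hdom).preimage_mem_nhds (by rw [hTx]; exact hU')))
  obtain ⟨C, hCC, hCo, hxC, hC⟩ :=
    locallyConnectedSpace_iff_subsets_isOpen_isConnected.1 V.locallyConnectedSpace _ _ hC₀
  filter_upwards [hN, (hCo.preimage V.continuous_proj).mem_nhds hxC] with z' hz' hz'C hproj
  have hmem : ∀ c ∈ C, (V.proj z', c) ∈ W ∧ T (z', c) ∈ U ∧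
      (V'.proj (T (z', c)), V'.proj x) ∈ W' := fun c hc => hsub (Set.mk_mem_prod hz' (hCC hc))
  refine ⟨T (z', V.proj x), (hmem _ hxC).2.1, hT.proj_apply (hmem _ hxC).1, ?_⟩
  have hself : T' (T (z', V.proj z'), V'.proj x) = z' := by
    rw [hT.apply_proj (hWd _), ← hproj, hT'.apply_proj (hWd' _)]
  refine V'.eqOn_of_lift (f := fun c => T' (T (z', c), V'.proj x)) (g := fun _ => z')
    hC.isPreconnected ?_ continuousOn_const (fun c hc => ?_) hz'C hself hxC
  · exact hT'.continuousOn.comp ((hT.continuousOn.comp (by fun_prop) fun c hc =>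
      (hmem c hc).1).prodMk continuousOn_const) fun c hc => (hmem c hc).2.2
  · rw [hT'.proj_apply (hmem c hc).2.2, hproj]

theorem eventually_loopLifts (x : S) {U : Set S} (hU : U ∈ 𝓝 x) :
    ∀ᶠ z' in 𝓝 x, V'.proj z' = V'.proj x → ∃ z ∈ U, V.proj z = V.proj x ∧
      ∀ Γ : C(unitInterval, S), Γ 0 = x → Γ 1 = x → V.LoopLifts Γ z → V'.LoopLifts Γ z' := by
  obtain ⟨W', hWo', hWd', T', hT'⟩ := V'.exists_isTransport
  obtain ⟨n, hn⟩ := V.exists_level_eq_imp_mem (O := {y | (V'.proj y.1, V'.proj y.2) ∈ W'})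
    (hWo'.preimage (by fun_prop)) fun a => hWd' _
  filter_upwards [hT'.eventually_exists_apply_eq V V' hWo' hWd' x
    (Filter.inter_mem hU (V.eventually_level_eq x n))] with z' hz' hproj
  obtain ⟨z, ⟨hzU, hzn⟩, hzx, rfl⟩ := hz' hproj
  refine ⟨z, hzU, hzx, fun Γ h0 h1 ⟨Δ, hΔ, hΔ0, hΔ1⟩ => ?_⟩
  -- A lift that agrees with `Γ` on level `n` at one time does so at all times.
  have hlevel := V.level_eq_of_lift Δ.continuous Γ.continuous hΔ (a₀ := 0)
    (by rw [hΔ0, h0]; exact hzn hzx)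
  have hlift := hT'.loopLifts (h0.trans h1.symm) (hΔ0.trans hΔ1.symm) fun t => hn _ _ (hlevel t)
  rwa [hΔ0, h0] at hlift

variable {V}

theorem loopLifts_iff_holonomy {γ : Path V.base V.base} {Γ : C(unitInterval, S)}
    (hΓ : ∀ t, V.proj (Γ t) = γ t) (z : V.carrier) :
    V.LoopLifts Γ z ↔ V.Holonomy (FundamentalGroup.fromPath (.mk γ)) z z := by
  simp only [LoopLifts, holonomy_fromPath_mk_iff, hΓ]

theorem Holonomy.unique {g : V.Grp} {y z w : V.carrier} (hz : V.Holonomy g y z)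
    (hw : V.Holonomy g y w) : z = w := by
  obtain ⟨γ, rfl, Γ, hΓ, hΓ0, hΓ1⟩ := hz
  obtain ⟨Δ, hΔ, hΔ0, hΔ1⟩ := V.holonomy_fromPath_mk_iff.1 hw
  exact Subtype.ext (by
    rw [← hΓ1, ← hΔ1, V.lift_end_eq_of_homotopic (.refl γ) hΓ hΔ (hΓ0.trans hΔ0.symm)])

theorem germTrivial_of_eventually_loopLifts {y : V.carrier}
    (h : ∀ Γ : C(unitInterval, S), Γ 0 = y → Γ 1 = y →
      ∀ᶠ z in 𝓝 (y : S), V.proj z = V.proj y → V.LoopLifts Γ z) : V.GermTrivial y := by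
  have hfix : ∀ g ∈ V.isotropy y, ∀ᶠ z in 𝓝 y, V.Holonomy g z z := by
    rintro g ⟨γ, rfl, Γ, hΓ, hΓ0, hΓ1⟩
    filter_upwards [continuous_subtype_val.continuousAt.eventually (h Γ hΓ0 hΓ1)] with z hz
    exact (loopLifts_iff_holonomy hΓ z).1 (hz (z.2.trans y.2.symm))
  refine ⟨fun g₁ g₂ => ?_⟩
  induction g₁ using Quotient.inductionOn with | _ g₁ => ?_
  induction g₂ using Quotient.inductionOn with | _ g₂ => ?_
  obtain ⟨U, hU, hUo, hyU⟩ := eventually_nhds_iff.1 ((hfix g₁ g₁.2).and (hfix g₂ g₂.2))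
  exact Quotient.sound ⟨U, hUo, hyU, fun z hz w =>
    ⟨fun hw => (hU z hz).1.unique hw ▸ (hU z hz).2, fun hw => (hU z hz).2.unique hw ▸ (hU z hz).1⟩⟩

theorem GermLocallyTrivial.eventually_loopLifts {x : V.carrier} (h : V.GermLocallyTrivial x) :
    ∀ᶠ z in 𝓝 (x : S), V.proj z = V.proj x →
      ∀ Γ : C(unitInterval, S), Γ 0 = x → Γ 1 = x → V.LoopLifts Γ z := by
  obtain ⟨U, hU, hxU, h⟩ := h
  obtain ⟨N, hN, rfl⟩ := isOpen_induced_iff.1 hU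
  filter_upwards [hN.mem_nhds hxU] with z hz hzx Γ h0 h1
  let γ : Path V.base V.base := ⟨⟨fun t => V.proj (Γ t), by fun_prop⟩,
    (congrArg V.proj h0).trans x.2, (congrArg V.proj h1).trans x.2⟩
  exact (loopLifts_iff_holonomy (γ := γ) (fun _ => rfl) ⟨z, hzx.trans x.2⟩).2
    (h _ ⟨γ, rfl, Γ, fun _ => rfl, h0, h1⟩ _ hz)

end TransverseSection

namespace Schori

/-! ### Surfaces glued from pieces -/

/-- The two curves of the surface of genus two. They also index the gluing permutations, and
generate the free group of words in the crossings. -/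
inductive Curve
  | C
  | D

instance : Finite Curve :=
  Finite.of_surjective (fun c : Bool => cond c .C .D) fun
    | .C => ⟨true, rfl⟩
    | .D => ⟨false, rfl⟩

/-- A crossing of a curve in the positive (`true`) or negative (`false`) direction. -/
abbrev Crossing : Type := Curve × Bool

/-- The same crossing in the opposite direction. -/
def Crossing.rev (s : Crossing) : Crossing := (s.1, !s.2)

/-- The plane domain underlying `Piece`. -/
def pieceSet : Set ℂ := {z | 1 / 2 < ‖z‖ ∧ ‖z‖ < 40 ∧ 1 / 2 < ‖z - 6‖ ∧ 1 / 2 < ‖z + 6‖}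

/-- The coordinate change at a crossing; see `Glue`. -/
noncomputable def cross : Crossing → ℂ → ℂ
  | (.C, true), z => 20 * z
  | (.C, false), z => z / 20
  | (.D, true), z => (z - 6)⁻¹ - 6
  | (.D, false), z => (z + 6)⁻¹ + 6

/-- The collar of a piece in which a crossing starts. -/
def collar : Crossing → Set ℂ
  | (.C, true) => {z | ‖z‖ < 2}
  | (.C, false) => {z | 10 < ‖z‖}
  | (.D, true) => {z | ‖z - 6‖ < 2}
  | (.D, false) => {z | ‖z + 6‖ < 2}

/-- The compact domain obtained from a piece by cutting off the collars at their core curves. -/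
def core : Set ℂ := {z | 1 ≤ ‖z‖ ∧ ‖z‖ ≤ 20 ∧ 1 ≤ ‖z - 6‖ ∧ 1 ≤ ‖z + 6‖}

theorem cross_rev_cross (s : Crossing) (z : ℂ) : cross s.rev (cross s z) = z := by
  obtain ⟨_ | _, _ | _⟩ := s <;> simp [cross, Crossing.rev]
  ring

theorem mem_collar {s : Crossing} {z : ℂ} (hz : z ∈ pieceSet) (hw : cross s z ∈ pieceSet) :
    z ∈ collar s := by
  obtain ⟨-, -, h6, h6'⟩ := hz
  obtain ⟨k0, k0', k6, k6'⟩ := hw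
  obtain ⟨_ | _, _ | _⟩ := s <;> simp only [cross, collar, Set.mem_ofPred_eq] at *
  · rw [norm_div, Complex.norm_ofNat] at k0
    linarith
  · rw [norm_mul, Complex.norm_ofNat] at k0'
    linarith
  · rw [add_sub_cancel_right, norm_inv, lt_inv_comm₀ (by norm_num) (by linarith)] at k6
    linarith
  · rw [sub_add_cancel, norm_inv, lt_inv_comm₀ (by norm_num) (by linarith)] at k6'
    linarith

/-- The comparisons of the distances of `z` to the centres `0`, `6`, `-6` of the holes on which all
estimates in the plane rest. -/
theorem norm_bounds (z : ℂ) : |z.re| ≤ ‖z‖ ∧ |z.re - 6| ≤ ‖z - 6‖ ∧ |z.re + 6| ≤ ‖z + 6‖ ∧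
    ‖z‖ ≤ ‖z - 6‖ + 6 ∧ ‖z‖ ≤ ‖z + 6‖ + 6 := by
  refine ⟨Complex.abs_re_le_norm z, by simpa using Complex.abs_re_le_norm (z - 6),
    by simpa using Complex.abs_re_le_norm (z + 6), ?_, ?_⟩
  · simpa using norm_add_le (z - 6) 6
  · simpa using norm_sub_le (z + 6) 6

theorem two_lt_norm_sub_of_mem_collar {s t : Crossing} (hst : s ≠ t) {z w : ℂ}
    (hz : z ∈ collar s) (hw : w ∈ collar t) : 2 < ‖z - w‖ := by
  have hz' := norm_bounds z
  have hw' := norm_bounds w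
  have hre : |z.re - w.re| ≤ ‖z - w‖ := Complex.abs_re_le_norm (z - w)
  have hzw := norm_sub_norm_le z w
  have hwz := norm_sub_norm_le w z
  rw [norm_sub_rev] at hwz
  simp only [abs_le] at hz' hw' hre
  obtain ⟨_ | _, _ | _⟩ := s <;> obtain ⟨_ | _, _ | _⟩ := t <;>
    first
    | exact absurd rfl hst
    | (simp only [collar, Set.mem_ofPred_eq] at hz hw; linarith)

theorem eq_of_mem_collar {s t : Crossing} {z : ℂ} (hs : z ∈ collar s) (ht : z ∈ collar t) :
    s = t := by
  by_contra hst
  have := two_lt_norm_sub_of_mem_collar hst hs ht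
  norm_num at this

theorem isOpen_pieceSet : IsOpen pieceSet :=
  (isOpen_lt continuous_const continuous_norm).and <|
    (isOpen_lt continuous_norm continuous_const).and <|
      (isOpen_lt continuous_const (by fun_prop)).and (isOpen_lt continuous_const (by fun_prop))

theorem core_subset_pieceSet : core ⊆ pieceSet := fun _ ⟨h0, h0', h6, h6'⟩ =>
  ⟨by linarith, by linarith, by linarith, by linarith⟩

theorem isCompact_core : IsCompact core := by
  refine (isCompact_closedBall (0 : ℂ) 20).of_isClosed_subset ?_ fun z hz => by
    simpa using hz.2.1
  refine IsClosed.and ?_ (IsClosed.and ?_ (IsClosed.and ?_ ?_)) <;>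
  exact isClosed_le (by fun_prop) (by fun_prop)

theorem mem_core_or_exists_cross_mem_core {z : ℂ} (hz : z ∈ pieceSet) :
    z ∈ core ∨ ∃ s, cross s z ∈ core := by
  obtain ⟨h0, h0', h6, h6'⟩ := hz
  have hinv : ∀ {r : ℝ}, 1 / 2 < r → r < 1 → 1 ≤ r⁻¹ ∧ r⁻¹ < 2 := fun hr hr' =>
    ⟨(one_le_inv₀ (by linarith)).2 hr'.le, (inv_lt_comm₀ (by linarith) two_pos).2 (by linarith)⟩
  have mem_core : ∀ w : ℂ, (1 ≤ ‖w‖ ∧ ‖w‖ ≤ 2 ∨ 10 ≤ ‖w‖ ∧ ‖w‖ ≤ 20) ∨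
      (1 ≤ ‖w - 6‖ ∧ ‖w - 6‖ ≤ 2) ∨ (1 ≤ ‖w + 6‖ ∧ ‖w + 6‖ ≤ 2) → w ∈ core := by
    intro w hw
    have hb := norm_bounds w
    simp only [abs_le] at hb
    rcases hw with (hw | hw) | hw | hw <;>
      exact ⟨by linarith, by linarith, by linarith, by linarith⟩
  by_cases c0 : ‖z‖ < 1
  · refine .inr ⟨(.C, true), mem_core _ (.inl (.inr ?_))⟩
    rw [cross, norm_mul, Complex.norm_ofNat]
    constructor <;> linarith
  by_cases c0' : 20 < ‖z‖
  · refine .inr ⟨(.C, false), mem_core _ (.inl (.inl ?_))⟩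
    rw [cross, norm_div, Complex.norm_ofNat]
    constructor <;> linarith
  by_cases c6 : ‖z - 6‖ < 1
  · refine .inr ⟨(.D, true), mem_core _ (.inr (.inr ?_))⟩
    rw [cross, sub_add_cancel, norm_inv]
    exact (hinv h6 c6).imp_right le_of_lt
  by_cases c6' : ‖z + 6‖ < 1
  · refine .inr ⟨(.D, false), mem_core _ (.inr (.inl ?_))⟩
    rw [cross, add_sub_cancel_right, norm_inv]
    exact (hinv h6' c6').imp_right le_of_lt
  exact .inl ⟨not_lt.1 c0, not_lt.1 c0', not_lt.1 c6, not_lt.1 c6'⟩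

theorem norm_sub_le_norm_add_mul_I_sub {z : ℂ} {t : ℝ} (ht : 0 ≤ t * z.im) (c : ℝ) :
    ‖z - c‖ ≤ ‖z + t * Complex.I - c‖ := by
  rw [← sq_le_sq₀ (norm_nonneg _) (norm_nonneg _), Complex.sq_norm, Complex.sq_norm,
    Complex.normSq_apply, Complex.normSq_apply]
  simp only [Complex.sub_re, Complex.sub_im, Complex.add_re, Complex.add_im, Complex.re_ofReal_mul,
    Complex.im_ofReal_mul, Complex.ofReal_re, Complex.ofReal_im, Complex.I_re, Complex.I_im]
  nlinarith

theorem add_mul_I_mem_pieceSet {z : ℂ} (hz : z ∈ pieceSet) {t : ℝ} (ht : 0 ≤ t * z.im)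
    (htz : ‖z + t * Complex.I‖ < 40) : z + t * Complex.I ∈ pieceSet := by
  have h0 := norm_sub_le_norm_add_mul_I_sub ht 0
  have h6 := norm_sub_le_norm_add_mul_I_sub ht 6
  have h6' := norm_sub_le_norm_add_mul_I_sub ht (-6)
  push_cast at h0 h6 h6'
  rw [sub_zero, sub_zero] at h0
  rw [sub_neg_eq_add, sub_neg_eq_add] at h6'
  exact ⟨hz.1.trans_le h0, htz, hz.2.2.1.trans_le h6, hz.2.2.2.trans_le h6'⟩

/-- The outer part of `pieceSet`, into which all other points are moved vertically. -/
def outerAnnulus : Set ℂ := {z | ‖z‖ ∈ Set.Ioo (7 : ℝ) 40}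

theorem outerAnnulus_subset_pieceSet : outerAnnulus ⊆ pieceSet := fun z ⟨h, h'⟩ => by
  have hb := norm_bounds z
  exact ⟨by linarith, h', by linarith, by linarith⟩

theorem isPreconnected_outerAnnulus : IsPreconnected outerAnnulus :=
  isPreconnected_setOf_norm_mem (by rw [Complex.rank_real_complex]; norm_num) isPreconnected_Ioo
    fun _ h => by linarith [h.1]

theorem exists_isPreconnected_mem_outerAnnulus {z : ℂ} (hz : z ∈ pieceSet) (h7 : ‖z‖ ≤ 7) :
    ∃ A ⊆ pieceSet, IsPreconnected A ∧ z ∈ A ∧ (A ∩ outerAnnulus).Nonempty := by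
  obtain ⟨T, hT, hTz⟩ : ∃ T : ℝ, |T| = 20 ∧ 0 ≤ T * z.im := by
    rcases le_total 0 z.im with h | h
    · exact ⟨20, by norm_num, by linarith⟩
    · exact ⟨-20, by norm_num, by linarith⟩
  let f : ℝ → ℂ := fun s => z + (s * T : ℝ) * Complex.I
  have hlt : ∀ s ∈ Set.Icc (0 : ℝ) 1, ‖f s‖ < 40 := fun s hs => by
    have h := norm_add_le z ((s * T : ℝ) * Complex.I)
    rw [norm_mul, Complex.norm_I, mul_one, Complex.norm_real, Real.norm_eq_abs, abs_mul, hT,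
      abs_of_nonneg hs.1] at h
    linarith [hs.2]
  have hout : 7 < ‖f 1‖ := by
    have h := norm_sub_le (f 1) z
    rw [add_sub_cancel_left, norm_mul, Complex.norm_I, mul_one, Complex.norm_real, one_mul,
      Real.norm_eq_abs, hT] at h
    linarith
  have h1 : (1 : ℝ) ∈ Set.Icc (0 : ℝ) 1 := ⟨zero_le_one, le_rfl⟩
  refine ⟨f '' Set.Icc 0 1, ?_, isPreconnected_Icc.image _ (by fun_prop),
    ⟨0, ⟨le_rfl, zero_le_one⟩, by simp [f]⟩, f 1, ⟨1, h1, rfl⟩, hout, hlt 1 h1⟩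
  rintro _ ⟨s, hs, rfl⟩
  exact add_mul_I_mem_pieceSet hz (by rw [mul_assoc]; exact mul_nonneg hs.1 hTz) (hlt s hs)

theorem isPreconnected_pieceSet : IsPreconnected pieceSet := by
  refine isPreconnected_of_forall (20 : ℂ) fun z hz => ?_
  have h20 : (20 : ℂ) ∈ outerAnnulus := by norm_num [outerAnnulus]
  rcases lt_or_ge 7 ‖z‖ with h7 | h7
  · exact ⟨_, outerAnnulus_subset_pieceSet, h20, ⟨h7, hz.2.1⟩, isPreconnected_outerAnnulus⟩
  · obtain ⟨A, hA, hAc, hzA, hne⟩ := exists_isPreconnected_mem_outerAnnulus hz h7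
    exact ⟨A ∪ outerAnnulus, Set.union_subset hA outerAnnulus_subset_pieceSet, .inr h20, .inl hzA,
      hAc.union' hne isPreconnected_outerAnnulus⟩

namespace Piece

theorem isOpenEmbedding_val : IsOpenEmbedding (Subtype.val : Piece → ℂ) :=
  isOpen_pieceSet.isOpenEmbedding_subtypeVal

instance : T2Space Piece := isOpenEmbedding_val.isEmbedding.t2Space

instance : PathConnectedSpace Piece :=
  isPathConnected_iff_pathConnectedSpace.1 <| isOpen_pieceSet.isConnected_iff_isPathConnected.1
    ⟨⟨20, outerAnnulus_subset_pieceSet (by norm_num [outerAnnulus])⟩, isPreconnected_pieceSet⟩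

theorem isCompact_preimage_core : IsCompact {z : Piece | z.1 ∈ core} :=
  isOpenEmbedding_val.isInducing.isCompact_preimage' isCompact_core
    (core_subset_pieceSet.trans Subtype.range_coe.ge)

theorem continuous_cross (s : Crossing) : Continuous fun z : Piece => cross s z.1 := by
  have hval : Continuous (Subtype.val : Piece → ℂ) := continuous_subtype_val
  obtain ⟨_ | _, _ | _⟩ := s <;> simp only [cross]
  · fun_prop
  · fun_prop
  · refine ((hval.add continuous_const).inv₀ fun z => ?_).add continuous_const
    exact norm_pos_iff.1 (one_half_pos.trans z.2.2.2.2)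
  · refine ((hval.sub continuous_const).inv₀ fun z => ?_).sub continuous_const
    exact norm_pos_iff.1 (one_half_pos.trans z.2.2.2.1)

/-- A neighbourhood of `z₀` no two points of which are glued to each other. -/
def smallNhd (z₀ : Piece) : Set Piece := {z | ‖z.1 - z₀.1‖ < 1}

theorem isOpen_smallNhd (z₀ : Piece) : IsOpen z₀.smallNhd :=
  isOpen_lt ((continuous_subtype_val.sub continuous_const).norm) continuous_const

theorem mem_smallNhd (z₀ : Piece) : z₀ ∈ z₀.smallNhd := by simp [smallNhd]

theorem norm_sub_le_two_of_mem_smallNhd {z₀ z w : Piece} (hz : z ∈ z₀.smallNhd)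
    (hw : w ∈ z₀.smallNhd) : ‖z.1 - w.1‖ ≤ 2 := by
  have h := norm_sub_le_norm_sub_add_norm_sub z.1 z₀.1 w.1
  rw [norm_sub_rev z₀.1] at h
  simp only [smallNhd, Set.mem_ofPred_eq] at hz hw
  linarith

end Piece

/-- The surface glued from pieces indexed by `ι`, where `σ c i` is the index of the piece reached
from the piece `i` by crossing the curve `c` in the positive direction. -/
def GluedSurface {ι : Type} (σ : Curve → Equiv.Perm ι) : Type := Quot (Glue (σ .C) (σ .D))

namespace GluedSurface

variable {ι : Type}

instance [TopologicalSpace ι] (σ : Curve → Equiv.Perm ι) : TopologicalSpace (GluedSurface σ) :=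
  inferInstanceAs (TopologicalSpace (Quot _))

/-- The point of the surface represented by a point of a piece. -/
def mk (σ : Curve → Equiv.Perm ι) (p : ι × Piece) : GluedSurface σ := Quot.mk _ p

/-- The index of the piece reached by a crossing in either direction. -/
def shift (σ : Curve → Equiv.Perm ι) (s : Crossing) : Equiv.Perm ι :=
  cond s.2 (σ s.1) (σ s.1)⁻¹

/-- `p` and `q` are glued at the crossing `s`. -/
def Adj (σ : Curve → Equiv.Perm ι) (s : Crossing) (p q : ι × Piece) : Prop :=
  q.1 = shift σ s p.1 ∧ (q.2.1 : ℂ) = cross s p.2.1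

variable {σ : Curve → Equiv.Perm ι}

theorem shift_rev_shift (s : Crossing) (i : ι) : shift σ s.rev (shift σ s i) = i := by
  obtain ⟨c, _ | _⟩ := s <;> simp [shift, Crossing.rev]

theorem Adj.symm {s : Crossing} {p q : ι × Piece} (h : Adj σ s p q) : Adj σ s.rev q p :=
  ⟨by rw [h.1, shift_rev_shift], by rw [h.2, cross_rev_cross]⟩

theorem Adj.mem_collar {s : Crossing} {p q : ι × Piece} (h : Adj σ s p q) : p.2.1 ∈ collar s :=
  Schori.mem_collar p.2.2 (h.2 ▸ q.2.2)

theorem Adj.two_lt_norm_sub {s : Crossing} {p q : ι × Piece} (h : Adj σ s p q) :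
    2 < ‖p.2.1 - q.2.1‖ := by
  refine two_lt_norm_sub_of_mem_collar (fun hs => ?_) h.mem_collar h.symm.mem_collar
  have := congrArg Prod.snd hs
  simp [Crossing.rev] at this

theorem Adj.eq_of_adj {s t : Crossing} {p q r : ι × Piece} (h : Adj σ s p q)
    (h' : Adj σ t q r) : r = p := by
  obtain rfl : s.rev = t := eq_of_mem_collar h.symm.mem_collar h'.mem_collar
  exact Prod.ext (by rw [h'.1, h.1, shift_rev_shift])
    (Subtype.ext (by rw [h'.2, h.2, cross_rev_cross]))

theorem glue_iff_exists_adj {p q : ι × Piece} :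
    Glue (σ .C) (σ .D) p q ↔ ∃ c, Adj σ (c, true) p q := by
  constructor
  · rintro (⟨v, z, w, h⟩ | ⟨v, z, w, h⟩)
    · exact ⟨.C, rfl, h⟩
    · exact ⟨.D, rfl, eq_sub_of_add_eq (eq_inv_of_mul_eq_one_right h)⟩
  · obtain ⟨i, z⟩ := p
    obtain ⟨j, w⟩ := q
    rintro ⟨_ | _, rfl, h⟩
    · exact Glue.crossC i z w h
    · have hz : z.1 - 6 ≠ 0 := norm_pos_iff.1 (one_half_pos.trans z.2.2.2.1)
      exact Glue.crossD i z w (by rw [h, cross, sub_add_cancel, mul_inv_cancel₀ hz])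

theorem mk_eq_mk_of_adj {s : Crossing} {p q : ι × Piece} (h : Adj σ s p q) :
    mk σ p = mk σ q := by
  obtain ⟨c, _ | _⟩ := s
  · exact (Quot.sound (glue_iff_exists_adj.2 ⟨c, h.symm⟩)).symm
  · exact Quot.sound (glue_iff_exists_adj.2 ⟨c, h⟩)

theorem mk_eq_mk {p q : ι × Piece} : mk σ p = mk σ q ↔ p = q ∨ ∃ s, Adj σ s p q := by
  refine ⟨fun h => ?_, ?_⟩
  · have hgen : Relation.EqvGen (Glue (σ .C) (σ .D)) p q := Quot.eqvGen_exact h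
    clear h
    induction hgen with
    | rel p q h =>
      obtain ⟨c, h⟩ := glue_iff_exists_adj.1 h
      exact .inr ⟨_, h⟩
    | refl p => exact .inl rfl
    | symm p q _ ih => exact ih.imp Eq.symm fun ⟨_, h⟩ => ⟨_, h.symm⟩
    | trans p q r _ _ ih ih' =>
      obtain rfl | ⟨s, h⟩ := ih
      · exact ih'
      · obtain rfl | ⟨t, h'⟩ := ih'
        · exact .inr ⟨s, h⟩
        · exact .inl (h.eq_of_adj h').symm
  · rintro (rfl | ⟨s, h⟩)
    · rfl
    · exact mk_eq_mk_of_adj h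

theorem eq_of_mk_eq_mk {p q : ι × Piece} (h : mk σ p = mk σ q) (hd : ‖p.2.1 - q.2.1‖ ≤ 2) :
    p = q :=
  (mk_eq_mk.1 h).resolve_right fun ⟨_, hs⟩ => hd.not_gt hs.two_lt_norm_sub

theorem mk_index_injective (z : Piece) : Function.Injective fun i => mk σ (i, z) := fun _ _ h =>
  congrArg Prod.fst (eq_of_mk_eq_mk h (by simp))

theorem mk_surjective : Function.Surjective (mk σ) := Quot.mk_surjective

section Topology

variable [TopologicalSpace ι]

theorem continuous_mk : Continuous (mk σ) := continuous_quot_mk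

theorem compactSpace [Finite ι] : CompactSpace (GluedSurface σ) := by
  refine ⟨(((Set.finite_univ (α := ι)).isCompact.prod Piece.isCompact_preimage_core).image
    (continuous_mk (σ := σ))).of_isClosed_subset isClosed_univ fun x _ => ?_⟩
  obtain ⟨⟨i, z⟩, rfl⟩ := mk_surjective x
  obtain hz | ⟨s, hs⟩ := mem_core_or_exists_cross_mem_core z.2
  · exact ⟨(i, z), ⟨trivial, hz⟩, rfl⟩
  · exact ⟨(shift σ s i, ⟨_, core_subset_pieceSet hs⟩), ⟨trivial, hs⟩,
      (mk_eq_mk_of_adj (s := s) ⟨rfl, rfl⟩).symm⟩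

variable [DiscreteTopology ι]

theorem isOpen_setOf_exists_adj (s : Crossing) {O : Set (ι × Piece)} (hO : IsOpen O) :
    IsOpen {p | ∃ q ∈ O, Adj σ s p q} := by
  let P : Set (ι × Piece) := {p | cross s p.2.1 ∈ pieceSet}
  have hP : IsOpen P := isOpen_pieceSet.preimage ((Piece.continuous_cross s).comp continuous_snd)
  let g : P → ι × Piece := fun p => (shift σ s p.1.1, ⟨cross s p.1.2.1, p.2⟩)
  have hg : Continuous g :=
    (continuous_of_discreteTopology.comp (continuous_fst.comp continuous_subtype_val)).prodMk
      (((Piece.continuous_cross s).comp (continuous_snd.comp continuous_subtype_val)).subtype_mk _)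
  convert hP.isOpenMap_subtype_val _ (hO.preimage hg) using 1
  ext p
  constructor
  · rintro ⟨q, hq, h⟩
    have hp : cross s p.2.1 ∈ pieceSet := h.2 ▸ q.2.2
    have hgq : g ⟨p, hp⟩ = q := Prod.ext h.1.symm (Subtype.ext h.2.symm)
    exact ⟨⟨p, hp⟩, by rwa [Set.mem_preimage, hgq], rfl⟩
  · rintro ⟨p, hp, rfl⟩
    exact ⟨g p, hp, rfl, rfl⟩

theorem isOpenMap_mk : IsOpenMap (mk σ) := by
  intro O hO
  have hpre : mk σ ⁻¹' (mk σ '' O) = O ∪ ⋃ s, {p | ∃ q ∈ O, Adj σ s p q} := by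
    ext p
    simp only [Set.mem_preimage, Set.mem_union, Set.mem_iUnion, Set.mem_ofPred_eq]
    constructor
    · rintro ⟨q, hq, h⟩
      obtain rfl | ⟨s, h⟩ := mk_eq_mk.1 h
      · exact .inl hq
      · exact .inr ⟨_, q, hq, h.symm⟩
    · rintro (h | ⟨s, q, hq, h⟩)
      · exact ⟨p, h, rfl⟩
      · exact ⟨q, hq, (mk_eq_mk_of_adj h).symm⟩
  have hopen : IsOpen (mk σ ⁻¹' (mk σ '' O)) :=
    hpre ▸ hO.union (isOpen_iUnion fun s => isOpen_setOf_exists_adj s hO)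
  exact isQuotientMap_quot_mk.isOpen_preimage.1 hopen

theorem t2Space : T2Space (GluedSurface σ) := by
  rw [t2Space_iff_of_isOpenQuotientMap (π := mk σ) ⟨mk_surjective, continuous_mk, isOpenMap_mk⟩]
  simp only [mk_eq_mk, Set.ofPred_or, Set.ofPred_exists]
  refine (isClosed_eq continuous_fst continuous_snd).union (isClosed_iUnion_of_finite fun s => ?_)
  refine IsClosed.and ?_ ?_
  · exact isClosed_eq (continuous_fst.comp continuous_snd)
      (continuous_of_discreteTopology.comp (continuous_fst.comp continuous_fst))
  · exact isClosed_eq (continuous_subtype_val.comp (continuous_snd.comp continuous_snd))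
      ((Piece.continuous_cross s).comp (continuous_snd.comp continuous_fst))

theorem isOpenEmbedding_smallNhd (z₀ : Piece) (J : Set ι) :
    IsOpenEmbedding fun x : z₀.smallNhd × J => mk σ (x.2.1, x.1.1) := by
  have hincl : IsOpenEmbedding fun x : z₀.smallNhd × J => ((x.2.1, x.1.1) : ι × Piece) :=
    ((isOpen_discrete J).isOpenEmbedding_subtypeVal.prodMap
      z₀.isOpen_smallNhd.isOpenEmbedding_subtypeVal).comp (Homeomorph.prodComm _ _).isOpenEmbedding
  refine .of_continuous_injective_isOpenMap (continuous_mk.comp hincl.continuous) (fun x y h => ?_)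
    (isOpenMap_mk.comp hincl.isOpenMap)
  exact hincl.injective
    (eq_of_mk_eq_mk h (Piece.norm_sub_le_two_of_mem_smallNhd x.1.2 y.1.2))

theorem isOpenEmbedding_smallNhd_index (z₀ : Piece) (i : ι) :
    IsOpenEmbedding fun w : z₀.smallNhd => mk σ (i, w) :=
  (isOpenEmbedding_smallNhd z₀ {i}).comp
    (Homeomorph.prodUnique z₀.smallNhd ({i} : Set ι)).symm.isOpenEmbedding

theorem nonempty_chartedSpace :
    Nonempty (ChartedSpace (EuclideanSpace ℝ (Fin 2)) (GluedSurface σ)) := by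
  have hE : IsOpenEmbedding fun z : Piece => Complex.orthonormalBasisOneI.repr z.1 :=
    Complex.orthonormalBasisOneI.repr.toHomeomorph.isOpenEmbedding.comp Piece.isOpenEmbedding_val
  have hchart : ∀ x : GluedSurface σ,
      ∃ e : OpenPartialHomeomorph (GluedSurface σ) (EuclideanSpace ℝ (Fin 2)), x ∈ e.source := by
    intro x
    obtain ⟨⟨i, z⟩, rfl⟩ := mk_surjective x
    have : Nonempty z.smallNhd := ⟨⟨z, z.mem_smallNhd⟩⟩
    have hmk := isOpenEmbedding_smallNhd_index (σ := σ) z i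
    have hrepr := hE.comp z.isOpen_smallNhd.isOpenEmbedding_subtypeVal
    refine ⟨(hmk.toOpenPartialHomeomorph _).symm.trans (hrepr.toOpenPartialHomeomorph _), ?_⟩
    simp only [OpenPartialHomeomorph.trans_source, OpenPartialHomeomorph.symm_source,
      IsOpenEmbedding.toOpenPartialHomeomorph_target,
      IsOpenEmbedding.toOpenPartialHomeomorph_source, Set.preimage_univ, Set.inter_univ]
    exact ⟨⟨z, z.mem_smallNhd⟩, rfl⟩
  choose e he using hchart
  exact ⟨⟨Set.range e, e, he, fun x => ⟨x, rfl⟩⟩⟩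

end Topology

section Map

variable {J : Type} {τ : Curve → Equiv.Perm J} {φ : ι → J}

/-- The map of surfaces induced by an equivariant map of the sets of indices. -/
def map (φ : ι → J) (hφ : ∀ c i, φ (σ c i) = τ c (φ i)) : GluedSurface σ → GluedSurface τ :=
  Quot.map (Prod.map φ id) (by
    rintro _ _ (⟨v, z, w, h⟩ | ⟨v, z, w, h⟩)
    · simpa only [Prod.map_apply, id_eq, hφ] using Glue.crossC (φ v) z w h
    · simpa only [Prod.map_apply, id_eq, hφ] using Glue.crossD (φ v) z w h)

variable {hφ : ∀ c i, φ (σ c i) = τ c (φ i)}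

theorem map_shift (hφ : ∀ c i, φ (σ c i) = τ c (φ i)) (s : Crossing) (i : ι) :
    φ (shift σ s i) = shift τ s (φ i) := by
  obtain ⟨c, _ | _⟩ := s
  · exact Equiv.Perm.eq_inv_iff_eq.2 (by simp [shift, ← hφ])
  · exact hφ c i

theorem exists_of_map_eq_mk {x : GluedSurface σ} {j : J} {z : Piece}
    (h : map φ hφ x = mk τ (j, z)) : ∃ i, φ i = j ∧ x = mk σ (i, z) := by
  obtain ⟨⟨i, w⟩, rfl⟩ := mk_surjective x
  obtain h | ⟨s, h⟩ := mk_eq_mk.1 h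
  · obtain ⟨hi, rfl⟩ := Prod.mk.inj h
    exact ⟨i, hi, rfl⟩
  · exact ⟨shift σ s i, (map_shift hφ s i).trans h.1.symm, mk_eq_mk_of_adj (s := s) ⟨rfl, h.2⟩⟩

theorem preimage_map_range_smallNhd (z₀ : Piece) (j : J) :
    map φ hφ ⁻¹' Set.range (fun w : z₀.smallNhd => mk τ (j, w)) =
      Set.range fun x : z₀.smallNhd × (φ ⁻¹' {j} : Set ι) => mk σ (x.2.1, x.1.1) := by
  ext x
  constructor
  · rintro ⟨w, hw⟩
    obtain ⟨i, hi, rfl⟩ := exists_of_map_eq_mk hw.symm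
    exact ⟨(w, ⟨i, hi⟩), rfl⟩
  · rintro ⟨⟨w, ⟨i, rfl⟩⟩, rfl⟩
    exact ⟨w, rfl⟩

variable [TopologicalSpace ι] [DiscreteTopology ι] [TopologicalSpace J]

theorem continuous_map : Continuous (map φ hφ) :=
  continuous_quot_lift _ (continuous_mk.comp (continuous_of_discreteTopology.prodMap continuous_id))

theorem isCoveringMap_map [DiscreteTopology J] : IsCoveringMap (map φ hφ) := by
  intro y
  obtain ⟨⟨j, z₀⟩, rfl⟩ := mk_surjective y
  suffices IsEvenlyCovered (map φ hφ) (mk τ (j, z₀)) (φ ⁻¹' {j}) from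
    this.to_isEvenlyCovered_preimage
  have hsheets := isOpenEmbedding_smallNhd (σ := σ) z₀ (φ ⁻¹' {j})
  have hbase := isOpenEmbedding_smallNhd_index (σ := τ) z₀ j
  have hrange := preimage_map_range_smallNhd (hφ := hφ) z₀ j
  refine ⟨inferInstance, Set.range fun w : z₀.smallNhd => mk τ (j, w),
    ⟨⟨z₀, z₀.mem_smallNhd⟩, rfl⟩, hbase.isOpen_range, hbase.isOpen_range.preimage continuous_map,
    ((Homeomorph.setCongr hrange).trans hsheets.isEmbedding.toHomeomorph.symm).trans
      (hbase.isEmbedding.toHomeomorph.prodCongr (Homeomorph.refl _)), ?_⟩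
  rintro ⟨x, hx⟩
  obtain ⟨⟨w, ⟨i, rfl⟩⟩, rfl⟩ : x ∈ Set.range _ := hrange ▸ hx
  have hcoord : hsheets.isEmbedding.toHomeomorph.symm (Homeomorph.setCongr hrange ⟨_, hx⟩) =
      (w, ⟨i, rfl⟩) := by
    rw [Homeomorph.symm_apply_eq]
    rfl
  simp only [Homeomorph.trans_apply, hcoord]
  rfl

end Map

end GluedSurface

theorem freeGroupLift_semiconj {α ι J : Type*} {σ : α → Equiv.Perm ι} {τ : α → Equiv.Perm J}
    {φ : ι → J} (hφ : ∀ a i, φ (σ a i) = τ a (φ i)) (f : FreeGroup α) (i : ι) :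
    φ (FreeGroup.lift σ f i) = FreeGroup.lift τ f (φ i) := by
  induction f using FreeGroup.induction_on generalizing i with
  | C1 => simp
  | of a => simp [hφ]
  | inv_of a _ => simp [Equiv.eq_symm_apply, ← hφ]
  | mul f g hf hg => simp [hf, hg]

namespace GluedSurface

variable {ι : Type} [TopologicalSpace ι] {σ : Curve → Equiv.Perm ι}

theorem joined_mk (i : ι) (z w : Piece) : Joined (mk σ (i, z)) (mk σ (i, w)) :=
  (PathConnectedSpace.joined z w).map (f := fun z => mk σ (i, z))
    (continuous_mk.comp (by fun_prop))

theorem joined_crossing (c : Curve) (i : ι) (z w : Piece) :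
    Joined (mk σ (i, z)) (mk σ (σ c i, w)) := by
  obtain ⟨z', w', h⟩ : ∃ z' w' : Piece, mk σ (i, z') = mk σ (σ c i, w') := by
    cases c
    · exact ⟨⟨1, by norm_num⟩, ⟨20, by norm_num⟩, Quot.sound (Glue.crossC _ _ _ (by norm_num))⟩
    · exact ⟨⟨7, by norm_num⟩, ⟨-5, by norm_num⟩, Quot.sound (Glue.crossD _ _ _ (by norm_num))⟩
  exact (joined_mk i z z').trans (h ▸ joined_mk _ w' w)

theorem joined_word (f : FreeGroup Curve) (i : ι) (z w : Piece) :
    Joined (mk σ (i, z)) (mk σ (FreeGroup.lift σ f i, w)) := by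
  induction f using FreeGroup.induction_on generalizing i z w with
  | C1 => simpa using joined_mk i z w
  | of c => simpa using joined_crossing c i z w
  | inv_of c h => simpa using (h ((FreeGroup.lift σ (.of c))⁻¹ i) w z).symm
  | mul f g hf hg => simpa using (hg i z z).trans (hf _ z w)

theorem pathConnectedSpace [Nonempty ι] (h : ∀ i j, ∃ f, FreeGroup.lift σ f i = j) :
    PathConnectedSpace (GluedSurface σ) := by
  obtain ⟨i₀⟩ := ‹Nonempty ι›
  obtain ⟨z₀⟩ := PathConnectedSpace.nonempty (X := Piece)
  refine ⟨⟨mk σ (i₀, z₀)⟩, fun x y => ?_⟩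
  obtain ⟨⟨i, z⟩, rfl⟩ := mk_surjective x
  obtain ⟨⟨j, w⟩, rfl⟩ := mk_surjective y
  obtain ⟨f, rfl⟩ := h i j
  exact joined_word f i z w

end GluedSurface

/-! ### Cutting and regluing -/

namespace Sheet

variable {ℓ : ℕ}

instance : Finite (Sheet ℓ) := by
  induction ℓ with
  | zero => exact inferInstanceAs (Finite Unit)
  | succ ℓ ih => exact inferInstanceAs (Finite (Sheet ℓ × Fin 3))

/-- The copy number `i` of the piece `v`. -/
def copy (v : Sheet ℓ) (i : Fin 3) : Sheet (ℓ + 1) := (v, i)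

/-- The piece of which `v` is a copy. -/
def pred (v : Sheet (ℓ + 1)) : Sheet ℓ := v.1

theorem pred_copy (v : Sheet ℓ) (i : Fin 3) : (v.copy i).pred = v := rfl

theorem copy_inj {v w : Sheet ℓ} {i j : Fin 3} : v.copy i = w.copy j ↔ v = w ∧ i = j :=
  Prod.mk_inj

theorem exists_eq_pred_copy (v : Sheet (ℓ + 1)) : ∃ i, v = v.pred.copy i := ⟨v.2, rfl⟩

end Sheet

section Regluing

variable {τ : Equiv.Perm (Fin 3)} {c : ∀ ℓ, Sheet ℓ} {ℓ : ℕ}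

theorem pred_regluing (v : Sheet (ℓ + 1)) :
    (regluing τ c (ℓ + 1) v).pred = regluing τ c ℓ v.pred := rfl

open Classical in
theorem iterate_regluing_copy (n : ℕ) (v : Sheet ℓ) (i : Fin 3) :
    (regluing τ c (ℓ + 1))^[n] (v.copy i) = ((regluing τ c ℓ)^[n] v).copy
      ((τ ^ Nat.count (fun j => (regluing τ c ℓ)^[j] v = c ℓ) n) i) := by
  induction n with
  | zero => rfl
  | succ n ih =>
    rw [Function.iterate_succ_apply', ih, Function.iterate_succ_apply', Nat.count_succ]
    change Sheet.copy _ ((if (regluing τ c ℓ)^[n] v = c ℓ then τ else 1) _) = _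
    split_ifs
    · rw [pow_succ', Equiv.Perm.mul_apply]
      rfl
    · rfl

theorem iterate_minimalPeriod_regluing_copy {v : Sheet ℓ}
    (h : (regluing τ c ℓ).SameCycle v (c ℓ)) (i : Fin 3) :
    (regluing τ c (ℓ + 1))^[Function.minimalPeriod (regluing τ c ℓ) v] (v.copy i) =
      v.copy (τ i) := by
  classical
  obtain ⟨m, hm⟩ := h.exists_nat_pow_eq
  rw [← Equiv.Perm.iterate_eq_pow] at hm
  have hcount := count_iterate_eq_minimalPeriod ((regluing τ c ℓ).injective.mem_periodicPts v) m
  rw [iterate_regluing_copy, Function.iterate_minimalPeriod]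
  simp only [← hm, hcount, pow_one]

theorem iterate_regluing_copy_of_not_sameCycle {v : Sheet ℓ}
    (h : ¬ (regluing τ c ℓ).SameCycle v (c ℓ)) (n : ℕ) (i : Fin 3) :
    (regluing τ c (ℓ + 1))^[n] (v.copy i) = ((regluing τ c ℓ)^[n] v).copy i := by
  classical
  have hne : ∀ j, (regluing τ c ℓ)^[j] v ≠ c ℓ := fun j hj => h ⟨j, by
    rw [← hj, zpow_natCast, Equiv.Perm.iterate_eq_pow]⟩
  simp only [iterate_regluing_copy, hne, Nat.count_false, pow_zero, Equiv.Perm.one_apply]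

theorem sameCycle_pred {v w : Sheet (ℓ + 1)} (h : (regluing τ c (ℓ + 1)).SameCycle v w) :
    (regluing τ c ℓ).SameCycle v.pred w.pred := by
  obtain ⟨n, rfl⟩ := h.exists_nat_pow_eq
  refine ⟨n, ?_⟩
  rw [zpow_natCast, ← Equiv.Perm.iterate_eq_pow, ← Equiv.Perm.iterate_eq_pow]
  exact (Function.Semiconj.iterate_right (f := Sheet.pred) pred_regluing n v).symm

theorem eq_of_sameCycle_copy {i j : Fin 3} (hi : τ i = i) {v w : Sheet ℓ}
    (h : (regluing τ c (ℓ + 1)).SameCycle (v.copy i) (w.copy j)) : i = j := by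
  obtain ⟨n, hn⟩ := h.exists_nat_pow_eq
  rw [← Equiv.Perm.iterate_eq_pow, iterate_regluing_copy, Sheet.copy_inj,
    Equiv.Perm.pow_apply_eq_self_of_apply_eq_self hi] at hn
  exact hn.2

end Regluing

/-- The exchange of two of the three copies that takes place when the cut along a lift of the curve
`c` is reglued. -/
def copySwap : Curve → Equiv.Perm (Fin 3)
  | .C => Equiv.swap 0 1
  | .D => Equiv.swap 1 2

namespace Cuts

variable (κ : Cuts) (ℓ : ℕ)

/-- The pieces from which the cuts along the lifts of the curve `c` are crossed. -/
def cut : Curve → ∀ ℓ, Sheet ℓ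
  | .C => κ.C
  | .D => κ.D

/-- The permutation of the pieces of `X_ℓ` given by crossing the lifts of the curve `c`. -/
noncomputable def perm (c : Curve) : Equiv.Perm (Sheet ℓ) := regluing (copySwap c) (κ.cut c) ℓ

/-- The action on the pieces of `X_ℓ` of the words in the two crossings. -/
noncomputable def word : FreeGroup Curve →* Equiv.Perm (Sheet ℓ) := FreeGroup.lift (κ.perm ℓ)

/-- The word of the closed loop through `x_ℓ` around the handle that the lift of the curve `c`
cuts. -/
noncomputable def handleWord (c : Curve) : FreeGroup Curve :=
  .of c ^ Function.minimalPeriod (κ.perm ℓ c) (baseSheet ℓ)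

variable {κ ℓ}

theorem sameCycle_baseSheet_cut (c : Curve) :
    (κ.perm ℓ c).SameCycle (baseSheet ℓ) (κ.cut c ℓ) := by
  cases c
  · exact κ.C_mem ℓ
  · exact κ.D_mem ℓ

theorem pred_word (f : FreeGroup Curve) (v : Sheet (ℓ + 1)) :
    (κ.word (ℓ + 1) f v).pred = κ.word ℓ f v.pred :=
  freeGroupLift_semiconj (φ := Sheet.pred) (fun _ => pred_regluing) f v

theorem word_of_pow (c : Curve) (n : ℕ) (v : Sheet ℓ) :
    κ.word ℓ (.of c ^ n) v = (κ.perm ℓ c)^[n] v := by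
  rw [map_pow, word, FreeGroup.lift_apply_of, Equiv.Perm.iterate_eq_pow]

theorem word_handleWord_copy (c : Curve) (i : Fin 3) :
    κ.word (ℓ + 1) (κ.handleWord ℓ c) ((baseSheet ℓ).copy i) =
      (baseSheet ℓ).copy (copySwap c i) :=
  (word_of_pow ..).trans (iterate_minimalPeriod_regluing_copy (sameCycle_baseSheet_cut c) i)

theorem exists_word_baseSheet_eq (v : Sheet ℓ) : ∃ f, κ.word ℓ f (baseSheet ℓ) = v := by
  induction ℓ with
  | zero => exact ⟨1, rfl⟩
  | succ ℓ ih =>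
    obtain ⟨f, hf⟩ := ih v.pred
    obtain ⟨j, hj⟩ := (κ.word (ℓ + 1) f⁻¹ v).exists_eq_pred_copy
    have hpred : (κ.word (ℓ + 1) f⁻¹ v).pred = baseSheet ℓ := by
      rw [pred_word, map_inv, Equiv.Perm.inv_eq_iff_eq, hf]
    rw [hpred] at hj
    obtain ⟨g, hg⟩ : ∃ g, κ.word (ℓ + 1) g (baseSheet (ℓ + 1)) = (baseSheet ℓ).copy j := by
      fin_cases j
      · exact ⟨κ.handleWord ℓ .C, word_handleWord_copy .C 1⟩
      · exact ⟨1, rfl⟩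
      · exact ⟨κ.handleWord ℓ .D, word_handleWord_copy .D 1⟩
    refine ⟨f * g, ?_⟩
    rw [map_mul, Equiv.Perm.mul_apply, hg, ← hj, ← Equiv.Perm.mul_apply, ← map_mul,
      mul_inv_cancel, map_one, Equiv.Perm.one_apply]

theorem exists_word_eq (v w : Sheet ℓ) : ∃ f, κ.word ℓ f v = w := by
  obtain ⟨f, rfl⟩ := exists_word_baseSheet_eq (κ := κ) v
  obtain ⟨g, rfl⟩ := exists_word_baseSheet_eq (κ := κ) w
  exact ⟨g * f⁻¹, by simp⟩

end Cuts

/-- The ends of the tree of pieces, on which the words in the crossings act. They index the pieces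
of the solenoid. -/
def Ends (_κ : Cuts) : Type := InverseLimit Sheet fun _ => Sheet.pred

namespace Ends

variable {κ : Cuts}

instance : TopologicalSpace (Ends κ) := inferInstanceAs (TopologicalSpace (InverseLimit _ _))

instance : CompactSpace (Ends κ) :=
  InverseLimit.compactSpace (fun _ => inferInstance) (fun _ => inferInstance)
    fun _ => continuous_of_discreteTopology

instance : T2Space (Ends κ) := InverseLimit.t2Space

instance : Nonempty (Ends κ) := ⟨⟨baseSheet, fun _ => rfl⟩⟩

noncomputable instance : MulAction (FreeGroup Curve) (Ends κ) where
  smul f v := ⟨fun ℓ => κ.word ℓ f (v.1 ℓ), fun ℓ =>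
    (Cuts.pred_word f _).trans (congrArg _ (v.2 ℓ))⟩
  one_smul v := Subtype.ext (funext fun ℓ => by
    change κ.word ℓ 1 (v.1 ℓ) = v.1 ℓ
    rw [map_one, Equiv.Perm.one_apply])
  mul_smul f g v := Subtype.ext (funext fun ℓ => by
    change κ.word ℓ (f * g) (v.1 ℓ) = κ.word ℓ f (κ.word ℓ g (v.1 ℓ))
    rw [map_mul, Equiv.Perm.mul_apply])

theorem level_smul (f : FreeGroup Curve) (v : Ends κ) (ℓ : ℕ) :
    (f • v).1 ℓ = κ.word ℓ f (v.1 ℓ) := rfl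

instance : ContinuousConstSMul (FreeGroup Curve) (Ends κ) where
  continuous_const_smul _ := InverseLimit.continuous_iff_level.2 fun ℓ =>
    continuous_of_discreteTopology.comp (InverseLimit.continuous_level ℓ)

theorem pred_level (v : Ends κ) (ℓ : ℕ) : (v.1 (ℓ + 1)).pred = v.1 ℓ := v.2 ℓ

theorem exists_level_eq {ℓ : ℕ} (v : Sheet ℓ) : ∃ e : Ends κ, e.1 ℓ = v := by
  obtain ⟨e⟩ : Nonempty (Ends κ) := inferInstance
  obtain ⟨f, hf⟩ := Cuts.exists_word_eq (κ := κ) (e.1 ℓ) v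
  exact ⟨f • e, hf⟩

theorem not_sameCycle_cut {c : Curve} {ℓ : ℕ} {i : Fin 3} (hi : copySwap c i = i) (hi1 : i ≠ 1)
    {v : Ends κ} (hv : v.1 (ℓ + 1) = (baseSheet ℓ).copy i) {m : ℕ} (hm : ℓ + 1 ≤ m) :
    ¬ (κ.perm m c).SameCycle (v.1 m) (κ.cut c m) := by
  suffices ¬ (κ.perm m c).SameCycle (v.1 m) (baseSheet m) from
    fun h => this (h.trans (Cuts.sameCycle_baseSheet_cut c).symm)
  induction m, hm using Nat.le_induction with
  | base => exact fun h => hi1 (eq_of_sameCycle_copy hi (hv ▸ h))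
  | succ m _ ih => exact fun h => ih (by simpa only [v.pred_level] using! sameCycle_pred h)

theorem of_pow_smul_eq_of_not_sameCycle {c : Curve} {v : Ends κ} {n k : ℕ}
    (hn : κ.word n (.of c ^ k) (v.1 n) = v.1 n)
    (hcut : ∀ m, n ≤ m → ¬ (κ.perm m c).SameCycle (v.1 m) (κ.cut c m)) :
    FreeGroup.of c ^ k • v = v := by
  have hup : ∀ m, n ≤ m → (FreeGroup.of c ^ k • v).1 m = v.1 m := by
    intro m hm
    induction m, hm using Nat.le_induction with
    | base => exact hn
    | succ m hm ih =>
      obtain ⟨i, hi⟩ := (v.1 (m + 1)).exists_eq_pred_copy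
      rw [v.pred_level] at hi
      rw [level_smul, Cuts.word_of_pow] at ih ⊢
      rw [hi]
      exact (iterate_regluing_copy_of_not_sameCycle (hcut m hm) k i).trans
        (congrArg (Sheet.copy · i) ih)
  refine Subtype.ext (funext fun m => ?_)
  obtain hm | hm := le_total n m
  · exact hup m hm
  · exact InverseLimit.level_eq_of_le hm (hup n le_rfl)

theorem handleWord_smul_eq {c : Curve} {ℓ : ℕ} {i : Fin 3} (hi : copySwap c i = i) (hi1 : i ≠ 1)
    {v : Ends κ} (hv : v.1 (ℓ + 1) = (baseSheet ℓ).copy i) : κ.handleWord ℓ c • v = v := by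
  refine of_pow_smul_eq_of_not_sameCycle (n := ℓ + 1) ?_ fun m => not_sameCycle_cut hi hi1 hv
  rw [hv]
  exact (Cuts.word_handleWord_copy c i).trans (by rw [hi])

/-- The word is a conjugate of that of a handle, which fixes the ends in one of the three copies and
exchanges the two other copies. -/
theorem exists_smul_eq_and_word_ne (v : Ends κ) (ℓ : ℕ) : ∃ f : FreeGroup Curve, f • v = v ∧
    ∃ w : Sheet (ℓ + 1), w.pred = v.1 ℓ ∧ κ.word (ℓ + 1) f w ≠ w := by
  obtain ⟨e, he⟩ := Cuts.exists_word_eq (κ := κ) (v.1 (ℓ + 1)) ((baseSheet ℓ).copy 2)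
  have he' : κ.word ℓ e (v.1 ℓ) = baseSheet ℓ := by
    rw [← v.pred_level, ← Cuts.pred_word, he, Sheet.pred_copy]
  have hfix : κ.handleWord ℓ .C • e • v = e • v := handleWord_smul_eq (by decide) (by decide) he
  refine ⟨e⁻¹ * κ.handleWord ℓ .C * e, by rw [mul_smul, mul_smul, hfix, inv_smul_smul],
    κ.word (ℓ + 1) e⁻¹ ((baseSheet ℓ).copy 0), ?_, fun h => ?_⟩
  · rw [Cuts.pred_word, Sheet.pred_copy, map_inv, Equiv.Perm.inv_eq_iff_eq, he']
  · rw [← Equiv.Perm.mul_apply, ← map_mul, mul_inv_cancel_right, map_mul, Equiv.Perm.mul_apply,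
      EmbeddingLike.apply_eq_iff_eq, Cuts.word_handleWord_copy, Sheet.copy_inj] at h
    exact absurd h.2 (by decide)

end Ends

/-! ### Leaves and holonomy of the Schori solenoid -/

instance : TopologicalSpace (FreeGroup Curve) := ⊥

instance : DiscreteTopology (FreeGroup Curve) := ⟨rfl⟩

theorem freeGroupLift_mulLeft {α : Type*} (f g : FreeGroup α) :
    FreeGroup.lift (fun a => Equiv.mulLeft (FreeGroup.of a)) f g = f * g := by
  have h : FreeGroup.lift (fun a : α => Equiv.mulLeft (FreeGroup.of a)) =
      MulAction.toPermHom (FreeGroup α) (FreeGroup α) :=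
    FreeGroup.ext_hom _ _ fun a => by
      rw [FreeGroup.lift_apply_of]
      rfl
  rw [h]
  rfl

/-- The covering of the genus two surface whose pieces are the words in the two crossings. It maps
onto every leaf of the solenoid. -/
abbrev FreeSurface : Type := GluedSurface fun c => Equiv.mulLeft (FreeGroup.of c)

/-- The point of `FreeSurface` given by a point of the piece `f`. -/
def freePt (f : FreeGroup Curve) (z : Piece) : FreeSurface := GluedSurface.mk _ (f, z)

theorem exists_eq_freePt (x : FreeSurface) : ∃ f z, x = freePt f z := by
  obtain ⟨⟨f, z⟩, rfl⟩ := GluedSurface.mk_surjective x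
  exact ⟨f, z, rfl⟩

instance : PathConnectedSpace FreeSurface :=
  GluedSurface.pathConnectedSpace fun f g =>
    ⟨g * f⁻¹, by rw [freeGroupLift_mulLeft, inv_mul_cancel_right]⟩

variable {κ : Cuts} {ℓ : ℕ}

/-- The point of `X_ℓ` given by a point of the piece `v`. -/
noncomputable def pt (κ : Cuts) (ℓ : ℕ) (v : Sheet ℓ) (z : Piece) : Surface κ ℓ :=
  GluedSurface.mk (κ.perm ℓ) (v, z)

theorem exists_eq_pt (x : Surface κ ℓ) : ∃ v z, x = pt κ ℓ v z := by
  obtain ⟨⟨v, z⟩, rfl⟩ := GluedSurface.mk_surjective (σ := κ.perm ℓ) x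
  exact ⟨v, z, rfl⟩

theorem pt_injective (z : Piece) : Function.Injective fun v => pt κ ℓ v z :=
  GluedSurface.mk_index_injective z

theorem bond_pt (v : Sheet (ℓ + 1)) (z : Piece) :
    bond κ ℓ (pt κ (ℓ + 1) v z) = pt κ ℓ v.pred z := rfl

theorem bond_eq_map : bond κ ℓ = GluedSurface.map (σ := κ.perm (ℓ + 1)) (τ := κ.perm ℓ)
    Sheet.pred fun _ => pred_regluing := rfl

theorem exists_of_bond_eq_pt {x : Surface κ (ℓ + 1)} {v : Sheet ℓ} {z : Piece}
    (h : bond κ ℓ x = pt κ ℓ v z) : ∃ w : Sheet (ℓ + 1), w.pred = v ∧ x = pt κ (ℓ + 1) w z :=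
  GluedSurface.exists_of_map_eq_mk (σ := κ.perm (ℓ + 1)) (τ := κ.perm ℓ)
    (hφ := fun _ => pred_regluing) h

theorem isCoveringMap_bond (κ : Cuts) (ℓ : ℕ) : IsCoveringMap (bond κ ℓ) := by
  rw [bond_eq_map]
  exact GluedSurface.isCoveringMap_map

theorem card_bond_fiber (y : Surface κ ℓ) : Nat.card (bond κ ℓ ⁻¹' {y}) = 3 := by
  obtain ⟨v, z, rfl⟩ := exists_eq_pt y
  let fiberPt : Fin 3 → bond κ ℓ ⁻¹' {pt κ ℓ v z} := fun i => ⟨pt κ (ℓ + 1) (v.copy i) z, rfl⟩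
  have hinj : Function.Injective fiberPt := fun i j h =>
    (Sheet.copy_inj.1 (pt_injective z (congrArg Subtype.val h))).2
  have hsurj : Function.Surjective fiberPt := by
    rintro ⟨x, hx⟩
    obtain ⟨w, rfl, rfl⟩ := exists_of_bond_eq_pt hx
    obtain ⟨i, hi⟩ := w.exists_eq_pred_copy
    exact ⟨i, Subtype.ext (congrArg (pt κ (ℓ + 1) · z) hi.symm)⟩
  rw [← Nat.card_eq_of_bijective fiberPt ⟨hinj, hsurj⟩, Nat.card_fin]

theorem isPresentation (κ : Cuts) : IsPresentation 2 (Surface κ) (bond κ) where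
  dim_pos := one_le_two
  compact ℓ := GluedSurface.compactSpace (σ := κ.perm ℓ)
  connected ℓ := by
    have : Nonempty (Sheet ℓ) := ⟨baseSheet ℓ⟩
    have : PathConnectedSpace (Surface κ ℓ) :=
      GluedSurface.pathConnectedSpace (σ := κ.perm ℓ) Cuts.exists_word_eq
    infer_instance
  hausdorff ℓ := GluedSurface.t2Space (σ := κ.perm ℓ)
  manifold ℓ := GluedSurface.nonempty_chartedSpace (σ := κ.perm ℓ)
  covering := isCoveringMap_bond κ
  degree _ := ⟨3, by norm_num, card_bond_fiber⟩

theorem word_mulLeft_of (v : Sheet ℓ) (c : Curve) (f : FreeGroup Curve) :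
    κ.word ℓ (Equiv.mulLeft (FreeGroup.of c) f) v = κ.perm ℓ c (κ.word ℓ f v) := by
  simp [Cuts.word]

/-- The covering `FreeSurface → X_ℓ` that maps the piece `1` to the piece `v`. -/
noncomputable def orbitMap (κ : Cuts) (ℓ : ℕ) (v : Sheet ℓ) : FreeSurface → Surface κ ℓ :=
  GluedSurface.map (τ := κ.perm ℓ) (fun f => κ.word ℓ f v) (word_mulLeft_of v)

theorem orbitMap_freePt (v : Sheet ℓ) (f : FreeGroup Curve) (z : Piece) :
    orbitMap κ ℓ v (freePt f z) = pt κ ℓ (κ.word ℓ f v) z := rfl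

theorem continuous_orbitMap (v : Sheet ℓ) : Continuous (orbitMap κ ℓ v) :=
  GluedSurface.continuous_map

theorem isCoveringMap_orbitMap (v : Sheet ℓ) : IsCoveringMap (orbitMap κ ℓ v) :=
  GluedSurface.isCoveringMap_map

theorem bond_orbitMap (v : Sheet (ℓ + 1)) (x : FreeSurface) :
    bond κ ℓ (orbitMap κ (ℓ + 1) v x) = orbitMap κ ℓ v.pred x := by
  obtain ⟨f, z, rfl⟩ := exists_eq_freePt x
  rw [orbitMap_freePt, orbitMap_freePt, bond_pt, Cuts.pred_word]

section Regularity

/-- A path in `X_ℓ` that starts in the piece `v` and makes the crossings of the word `f`. -/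
noncomputable def wordPath (κ : Cuts) (v : Sheet ℓ) (f : FreeGroup Curve) (z : Piece) :
    Path (pt κ ℓ v z) (pt κ ℓ (κ.word ℓ f v) z) :=
  ((PathConnectedSpace.somePath (freePt 1 z) (freePt f z)).map (continuous_orbitMap v)).cast
    (by rw [orbitMap_freePt, map_one, Equiv.Perm.one_apply]) rfl

theorem bond_wordPath (v : Sheet (ℓ + 1)) (f : FreeGroup Curve) (z : Piece) (t : unitInterval) :
    bond κ ℓ (wordPath κ v f z t) = wordPath κ v.pred f z t :=
  bond_orbitMap v _

/-- The class of the loop at `pt κ ℓ v z` that makes the crossings of the word `f`. -/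
noncomputable def wordLoop {v : Sheet ℓ} {f : FreeGroup Curve} (hf : κ.word ℓ f v = v)
    (z : Piece) : FundamentalGroup (Surface κ ℓ) (pt κ ℓ v z) :=
  .fromPath (.mk ((wordPath κ v f z).cast rfl (by rw [hf])))

theorem monodromyPerm_wordLoop {v : Sheet ℓ} {f : FreeGroup Curve} (hf : κ.word ℓ f v = v)
    {z : Piece} {w : Sheet (ℓ + 1)} (e : bond κ ℓ ⁻¹' {pt κ ℓ v z})
    (he : e.1 = pt κ (ℓ + 1) w z) :
    ((isCoveringMap_bond κ ℓ).monodromyPerm (pt κ ℓ v z) (wordLoop hf z) e : Surface κ (ℓ + 1)) =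
      pt κ (ℓ + 1) (κ.word (ℓ + 1) f w) z := by
  obtain rfl : w.pred = v := pt_injective z ((congrArg (bond κ ℓ) he).symm.trans e.2)
  refine (monodromy_mk_eq (isCoveringMap_bond κ ℓ) (Γ := (wordPath κ w f z).toContinuousMap)
    (bond_wordPath w f z) e ?_).trans (wordPath κ w f z).target
  exact (wordPath κ w f z).source.trans he.symm

theorem not_normal_range_bond (x : Surface κ (ℓ + 1)) : ¬ (FundamentalGroup.map
    (⟨bond κ ℓ, continuous_bond κ ℓ⟩ : C(Surface κ (ℓ + 1), Surface κ ℓ)) x).range.Normal := by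
  obtain ⟨v, z, rfl⟩ := exists_eq_pt x
  obtain ⟨u, rfl⟩ := Ends.exists_level_eq (κ := κ) v
  obtain ⟨f, hf, w, hw, hne⟩ := u.exists_smul_eq_and_word_ne ℓ
  obtain ⟨g, rfl⟩ := Cuts.exists_word_eq (κ := κ) (u.1 (ℓ + 1)) w
  have hfu : ∀ m, κ.word m f (u.1 m) = u.1 m := fun m => congrArg (·.1 m) hf
  have hg' : κ.word ℓ g (u.1 (ℓ + 1)).pred = (u.1 (ℓ + 1)).pred := by
    rw [← Cuts.pred_word, hw, u.pred_level]
  have hf' : κ.word ℓ f (u.1 (ℓ + 1)).pred = (u.1 (ℓ + 1)).pred := by rw [← Cuts.pred_word, hfu]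
  refine not_normal_range_map_of_monodromyPerm (isCoveringMap_bond κ ℓ) (g := wordLoop hf' z)
    (h := wordLoop hg' z) (Subtype.ext ?_) fun h => hne (pt_injective (κ := κ) z ?_)
  · exact (monodromyPerm_wordLoop hf' _ rfl).trans (by rw [hfu])
  · have hg := monodromyPerm_wordLoop hg' ⟨pt κ (ℓ + 1) (u.1 (ℓ + 1)) z, rfl⟩ rfl
    exact (monodromyPerm_wordLoop hf' _ hg).symm.trans ((congrArg Subtype.val h).trans hg)

end Regularity

section Holonomy

/-- The point of the solenoid given by a point of the piece `v`. -/
noncomputable def endPt (v : Ends κ) (z : Piece) : Solenoid κ :=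
  ⟨fun ℓ => pt κ ℓ (v.1 ℓ) z, fun ℓ => by rw [bond_pt, v.pred_level]⟩

theorem endPt_injective (z : Piece) : Function.Injective fun v : Ends κ => endPt v z :=
  fun _ _ h => Subtype.ext (funext fun ℓ =>
    pt_injective z (congrArg (fun s : Solenoid κ => s.1 ℓ) h))

theorem continuous_endPt (z : Piece) : Continuous fun v : Ends κ => endPt v z :=
  InverseLimit.continuous_iff_level.2 fun ℓ =>
    (continuous_of_discreteTopology (f := fun v : Sheet ℓ => pt κ ℓ v z)).comp
      (InverseLimit.continuous_level ℓ)

theorem isEmbedding_endPt (z : Piece) : IsEmbedding fun v : Ends κ => endPt v z := by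
  have : T2Space (Solenoid κ) :=
    have := (isPresentation κ).hausdorff
    InverseLimit.t2Space
  exact ((continuous_endPt z).isClosedEmbedding (endPt_injective z)).isEmbedding

theorem exists_eq_endPt_of_level_zero {s : Solenoid κ} {z : Piece} {v₀ : Sheet 0}
    (h : s.1 0 = pt κ 0 v₀ z) : ∃ v, s = endPt v z := by
  have hlevel : ∀ ℓ, ∃ v : Sheet ℓ, s.1 ℓ = pt κ ℓ v z := by
    intro ℓ
    induction ℓ with
    | zero => exact ⟨v₀, h⟩
    | succ ℓ ih =>
      obtain ⟨v, hv⟩ := ih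
      obtain ⟨w, -, hw⟩ := exists_of_bond_eq_pt ((s.2 ℓ).trans hv)
      exact ⟨w, hw⟩
  choose v hv using hlevel
  have hpred : ∀ ℓ, (v (ℓ + 1)).pred = v ℓ := fun ℓ => pt_injective (κ := κ) z <| by
    simp only [← bond_pt, ← hv, s.2]
  exact ⟨⟨v, hpred⟩, Subtype.ext (funext hv)⟩

theorem exists_eq_endPt (s : Solenoid κ) : ∃ v z, s = endPt v z := by
  obtain ⟨v₀, z, h⟩ := exists_eq_pt (s.1 0)
  obtain ⟨v, hv⟩ := exists_eq_endPt_of_level_zero h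
  exact ⟨v, z, hv⟩

/-- The transverse sections given by the defining presentation of the Schori solenoid. -/
def stdSection (κ : Cuts) (b : Surface κ 0) : TransverseSection.{0} (Solenoid κ) where
  dim := 2
  M := Surface κ
  bond := bond κ
  isPresentation := isPresentation κ
  homeo := Homeomorph.refl _
  base := b

variable {b : Surface κ 0}

theorem proj_endPt (v : Ends κ) (z : Piece) :
    (stdSection κ b).proj (endPt v z) = pt κ 0 (baseSheet 0) z := rfl

/-- The map onto the leaf of the end `v` that maps the piece `1` to the piece `v`. -/
noncomputable def leafMap (v : Ends κ) (x : FreeSurface) : Solenoid κ :=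
  ⟨fun ℓ => orbitMap κ ℓ (v.1 ℓ) x, fun ℓ => by rw [bond_orbitMap, v.pred_level]⟩

theorem continuous_leafMap (v : Ends κ) : Continuous (leafMap v) :=
  InverseLimit.continuous_iff_level.2 fun _ => continuous_orbitMap _

theorem leafMap_freePt (v : Ends κ) (f : FreeGroup Curve) (z : Piece) :
    leafMap v (freePt f z) = endPt (f • v) z := rfl

theorem leafMap_freePt_one (v : Ends κ) (z : Piece) : leafMap v (freePt 1 z) = endPt v z := by
  rw [leafMap_freePt, one_smul]

theorem exists_leafMap_eq {Γ : C(unitInterval, Solenoid κ)} {v w : Ends κ} {z z' : Piece}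
    (h0 : Γ 0 = endPt v z) (h1 : Γ 1 = endPt w z') :
    ∃ (f : FreeGroup Curve) (P : Path (freePt 1 z) (freePt f z')),
      f • v = w ∧ ∀ t, Γ t = leafMap v (P t) := by
  let V := stdSection κ (pt κ 0 (baseSheet 0) z)
  obtain ⟨P, hP, hP0⟩ := (isCoveringMap_orbitMap (v.1 0)).exists_path_lifts
    ⟨fun t => V.proj (Γ t), by fun_prop⟩ (freePt 1 z) (congrArg V.proj h0)
  have hleaf : ∀ t, Γ t = leafMap v (P t) :=
    V.eq_of_lift Γ.continuous ((continuous_leafMap v).comp P.continuous)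
      (fun t => (congrFun hP t).symm) (a₀ := 0)
      (h0.trans ((leafMap_freePt_one v z).symm.trans (congrArg (leafMap v) hP0.symm)))
  obtain ⟨f, -, hf⟩ := GluedSurface.exists_of_map_eq_mk (hφ := word_mulLeft_of (v.1 0))
    ((congrFun hP 1).trans (congrArg V.proj h1))
  refine ⟨f, ⟨P, hP0, hf⟩, endPt_injective (κ := κ) z' ?_, hleaf⟩
  exact (congrArg (leafMap v) hf).symm.trans ((hleaf 1).symm.trans h1)

theorem exists_smul_eq_of_mem_pathComponent {v w : Ends κ} {z z' : Piece}
    (h : endPt w z' ∈ pathComponent (endPt v z)) : ∃ f : FreeGroup Curve, f • v = w := by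
  obtain ⟨γ⟩ := h
  obtain ⟨f, -, hf, -⟩ := exists_leafMap_eq (Γ := γ.toContinuousMap) γ.source γ.target
  exact ⟨f, hf⟩

theorem loopLifts_endPt_iff {f : FreeGroup Curve} {z : Piece} {P : Path (freePt 1 z) (freePt f z)}
    {v : Ends κ} {Γ : C(unitInterval, Solenoid κ)} (hΓ : ∀ t, Γ t = leafMap v (P t))
    (u : Ends κ) : (stdSection κ b).LoopLifts Γ (endPt u z) ↔ f • u = u := by
  let lift : C(unitInterval, Solenoid κ) :=
    ⟨fun t => leafMap u (P t), (continuous_leafMap u).comp P.continuous⟩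
  have hlift : ∀ t, (stdSection κ b).proj (lift t) = (stdSection κ b).proj (Γ t) := fun t => by
    rw [hΓ]
    rfl
  have h0 : lift 0 = endPt u z := (congrArg (leafMap u) P.source).trans (leafMap_freePt_one u z)
  have h1 : lift 1 = endPt (f • u) z := congrArg (leafMap u) P.target
  constructor
  · rintro ⟨Δ, hΔ, hΔ0, hΔ1⟩
    have hend := (stdSection κ b).eq_of_lift Δ.continuous lift.continuous
      (fun t => (hΔ t).trans (hlift t).symm) (hΔ0.trans h0.symm) 1
    exact endPt_injective z (h1.symm.trans (hend.symm.trans hΔ1))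
  · exact fun hu => ⟨lift, hlift, h0, by rw [h1, hu]⟩

theorem exists_loop_of_smul_eq {f : FreeGroup Curve} {v : Ends κ} (hf : f • v = v) (z : Piece) :
    ∃ Γ : C(unitInterval, Solenoid κ), Γ 0 = endPt v z ∧ Γ 1 = endPt v z ∧
      ∀ u, (stdSection κ b).LoopLifts Γ (endPt u z) ↔ f • u = u := by
  let P : Path (freePt 1 z) (freePt f z) := PathConnectedSpace.somePath _ _
  refine ⟨⟨fun t => leafMap v (P t), (continuous_leafMap v).comp P.continuous⟩, ?_, ?_,
    loopLifts_endPt_iff fun _ => rfl⟩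
  · exact (congrArg (leafMap v) P.source).trans (leafMap_freePt_one v z)
  · exact (congrArg (leafMap v) P.target).trans (by rw [leafMap_freePt, hf])

theorem germTrivial_of_isHolonomyFree {v : Ends κ} (hv : IsHolonomyFree (FreeGroup Curve) v)
    (V : TransverseSection.{u} (Solenoid κ)) {y : V.carrier} {z : Piece}
    (hy : (y : Solenoid κ) = endPt v z) : V.GermTrivial y := by
  refine TransverseSection.germTrivial_of_eventually_loopLifts fun Γ h0 h1 => ?_
  obtain ⟨f, P, hf, hP⟩ := exists_leafMap_eq (h0.trans hy) (h1.trans hy)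
  have hfix : ∀ᶠ s in 𝓝 (y : Solenoid κ), ∀ w, endPt w z = s → f • w = w := by
    rw [hy, ← Filter.eventually_comap, ← (isEmbedding_endPt z).nhds_eq_comap]
    exact hv f hf
  let b := pt κ 0 (baseSheet 0) z
  filter_upwards [(stdSection κ b).eventually_loopLifts V y hfix] with z' hz' hproj
  obtain ⟨s, hs, hsy, hlift⟩ := hz' hproj
  rw [hy, proj_endPt] at hsy
  obtain ⟨w, rfl⟩ := exists_eq_endPt_of_level_zero hsy
  exact hlift Γ h0 h1 ((loopLifts_endPt_iff hP w).2 (hs w rfl))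

theorem exists_germTrivial_leaf (κ : Cuts) : ∃ x : Solenoid κ,
    ∀ (V : TransverseSection.{u} (Solenoid κ)) (y : V.carrier),
      (y : Solenoid κ) ∈ pathComponent x → V.GermTrivial y := by
  obtain ⟨v, hv⟩ := (dense_setOf_isHolonomyFree (G := FreeGroup Curve) (X := Ends κ)).nonempty
  obtain ⟨z₀⟩ := PathConnectedSpace.nonempty (X := Piece)
  refine ⟨endPt v z₀, fun V y hy => ?_⟩
  obtain ⟨w, z, hw⟩ := exists_eq_endPt y.1
  rw [hw] at hy
  obtain ⟨f, rfl⟩ := exists_smul_eq_of_mem_pathComponent hy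
  exact germTrivial_of_isHolonomyFree (hv.smul f) V hw

theorem exists_smul_eq_of_germLocallyTrivial {V : TransverseSection.{u} (Solenoid κ)}
    {x : V.carrier} (hx : V.GermLocallyTrivial x) {v : Ends κ} {z : Piece}
    (hv : (x : Solenoid κ) = endPt v z) :
    ∀ᶠ w in 𝓝 v, ∀ f : FreeGroup Curve, f • v = v → f • w = w := by
  let b := pt κ 0 (baseSheet 0) z
  have hev := V.eventually_loopLifts (stdSection κ b) x hx.eventually_loopLifts
  rw [hv] at hev
  filter_upwards [(continuous_endPt z).continuousAt.eventually hev] with w hw f hf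
  obtain ⟨s, hs, hsx, hlift⟩ := hw rfl
  obtain ⟨Γ, h0, h1, hΓ⟩ := exists_loop_of_smul_eq (b := b) hf z
  exact (hΓ w).1 (hlift Γ h0 h1 (hs hsx Γ h0 h1))

theorem not_germLocallyTrivial (V : TransverseSection.{u} (Solenoid κ)) (x : V.carrier) :
    ¬ V.GermLocallyTrivial x := by
  intro hx
  obtain ⟨v, z, hv⟩ := exists_eq_endPt x.1
  obtain ⟨n, hn⟩ := InverseLimit.exists_cylinder_subset (fun _ => inferInstance)
    (fun _ => inferInstance) (fun _ => continuous_of_discreteTopology)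
    (exists_smul_eq_of_germLocallyTrivial hx hv)
  obtain ⟨f, hf, w, hw, hne⟩ := v.exists_smul_eq_and_word_ne n
  obtain ⟨u, rfl⟩ := Ends.exists_level_eq (κ := κ) w
  exact hne (congrArg (·.1 (n + 1)) (hn u ((u.pred_level n).symm.trans hw) f hf))

end Holonomy

end Schori

theorem mainTheorem4 (κ : Schori.Cuts) :
    -- the bonding maps are non-regular 3-fold coverings of closed connected surfaces
    IsPresentation 2 (Schori.Surface κ) (Schori.bond κ) ∧
    (∀ ℓ y, Nat.card (Schori.bond κ ℓ ⁻¹' {y}) = 3) ∧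
    (∀ ℓ x, ¬ (FundamentalGroup.map
      (⟨Schori.bond κ ℓ, Schori.continuous_bond κ ℓ⟩ :
        C(Schori.Surface κ (ℓ + 1), Schori.Surface κ ℓ)) x).range.Normal) ∧
    -- there is a leaf with trivial germinal holonomy
    (∃ x : Schori.Solenoid κ, ∀ (V : TransverseSection.{u} (Schori.Solenoid κ)) (y : V.carrier),
      (y : Schori.Solenoid κ) ∈ pathComponent x → V.GermTrivial y) ∧
    -- for every section and every point, the germinal holonomy is not locally trivial
    (∀ (V : TransverseSection.{u} (Schori.Solenoid κ)) (x : V.carrier),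
      ¬ V.GermLocallyTrivial x) :=
  ⟨Schori.isPresentation κ, fun _ => Schori.card_bond_fiber, fun _ => Schori.not_normal_range_bond,
    Schori.exists_germTrivial_leaf κ, Schori.not_germLocallyTrivial⟩
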